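/- Let $E,F$ be complex Banach spaces, $U\subseteq E$ open, $v\colon U\to(0,\infty)$ continuous, and $p\in(1,\infty)$ with conjugate index $p^*=p/(p-1)$. Let $\mathcal H_v^\infty(U,F)$ be the space of holomorphic mappings $f\colon U\to F$ with $\|f\|_v:=\sup_{x\in U}v(x)\|f(x)\|<\infty$, normed by $\|\cdot\|_v$, and put $\mathcal H_v^\infty(U)=\mathcal H_v^\infty(U,\mathbb C)$. For a complex Banach space $X$ with closed dual unit ball $B_{X^*}$, let $\ell_p(X)$ be the set of sequences in $X$ with $\|(x_n)\|_p:=(\sum_n\|x_n\|^p)^{1/p}<\infty$, and let $\ell_p^u(X)$ be the set of sequences in $X$ with $\|(x_n)\|_p^w:=\sup_{x^*\in B_{X^*}}\|(x^*(x_n))_n\|_p<\infty$ and $\lim_{m\to\infty}\|(x_n)_{n\ge m}\|_p^w=0$. Put $p\text{-}\mathrm{conv}(x_n)=\{\sum_n a_nx_n\colon (a_n)\in \ell_{p^*},\ \|(a_n)\|_{p^*}\le 1\}$. A set $K\subseteq X$ is relatively $p$-compact (resp. relatively unconditionally $p$-compact) if $K\subseteq p\text{-}\mathrm{conv}(x_n)$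 for some $(x_n)$ in $\ell_p(X)$ (resp. $\ell_p^u(X)$); $m_{\mathcal K_p}(K)$ (resp. $m_{\mathcal K_{up}}(K)$) denotes the infimum of $\|(x_n)\|_p$ (resp. $\|(x_n)\|_p^w$) over all such sequences. A bounded operator $T\colon X\to Y$ between complex normed spaces, with $X$ a Banach space, is quasi $p$-nuclear (resp. quasi unconditionally $p$-nuclear) if there is $(x_n^*)$ in $\ell_p(X^*)$ (resp. $\ell_p^u(X^*)$) such that $\|T(x)\|\le\|(x_n^*(x))_n\|_p$ for all $x\in X$; $\|T\|_{\mathcal{QN}_p}$ (resp. $\|T\|_{\mathcal{QN}_{up}}$) is the infimum of $\|(x_n^*)\|_p$ (resp. $\|(x_n^*)\|_p^w$) over all such sequences. Let $\mathcal I=\mathcal K_p$ and $i=p$ (resp. $\mathcal I=\mathcal K_{up}$ and $i=up$). Let $\mathcal H^\infty_{v\mathcal I}(U,F)$ be the set of $f\in\mathcal H_v^\infty(U,F)$ for which $(vf)(U)=\{v(x)f(x)\colon x\in U\}$ is relatively $p$-compact (resp. relatively unconditionally $p$-compact) in $F$, with $\|f\|_{\mathcal H^\infty_{v\mathcal I}}:=m_{\mathcal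 I}((vf)(U))$. For every $f\in\mathcal H_v^\infty(U,F)$, we have $f\in\mathcal H^\infty_{v\mathcal I}(U,F)$ if and only if its transpose $f^t\colon F^*\to\mathcal H_v^\infty(U)$, $f^t(y^*)=y^*\circ f$, is quasi $p$-nuclear (resp. quasi unconditionally $p$-nuclear). In that case, $\|f\|_{\mathcal H^\infty_{v\mathcal I}}=\|f^t\|_{\mathcal{QN}_i}$. -/

import Mathlib

open Filter Topology
open scoped ENNReal

noncomputable section

/-! ### Sequence spaces -/

/-- The extended `p`-norm `(∑ ‖x n‖ ^ p) ^ (1 / p)` of a sequence, with value `∞` exactly when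
the sequence is not `p`-summable. -/
def seqENorm {X : Type*} [NormedAddCommGroup X] (p : ℝ) (x : ℕ → X) : ℝ≥0∞ :=
  (∑' n, ‖x n‖ₑ ^ p) ^ (1 / p)

/-- The extended weak `p`-norm: the supremum of the `p`-norms of the sequences `φ (x n)`, for `φ`
in the closed unit ball of the dual. -/
def weakSeqENorm {X : Type*} [NormedAddCommGroup X] [NormedSpace ℂ X] (p : ℝ) (x : ℕ → X) :
    ℝ≥0∞ :=
  ⨆ φ ∈ Metric.closedBall (0 : StrongDual ℂ X) 1, seqENorm p (fun n => φ (x n))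

/-- `ℓ_p(X)`, the `p`-summable sequences. -/
def pSummable (p : ℝ) (X : Type*) [NormedAddCommGroup X] : Set (ℕ → X) :=
  {x | seqENorm p x < ∞}

/-- `ℓ_p^w(X)`, the weakly `p`-summable sequences. -/
def weaklyPSummable (p : ℝ) (X : Type*) [NormedAddCommGroup X] [NormedSpace ℂ X] :
    Set (ℕ → X) :=
  {x | weakSeqENorm p x < ∞}

/-- `ℓ_p^u(X)`, the unconditionally `p`-summable sequences: those weakly `p`-summable sequences
whose tails tend to zero in the weak `p`-norm. -/
def unconditionallyPSummable (p : ℝ) (X : Type*) [NormedAddCommGroup X] [NormedSpace ℂ X] :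
    Set (ℕ → X) :=
  {x | x ∈ weaklyPSummable p X ∧
    Tendsto (fun m : ℕ => weakSeqENorm p (fun n => x (n + m))) atTop (𝓝 0)}

/-! ### `p`-compact and unconditionally `p`-compact sets, for `1 < p < ∞` -/

/-- The `p`-convex hull of a sequence, for `1 < p < ∞`: all sums `∑ a n • x n` with `a` in the
closed unit ball of `ℓ_{p*}`, where `p* = p / (p - 1)`. -/
def pConv {X : Type*} [NormedAddCommGroup X] [NormedSpace ℂ X] (p : ℝ) (x : ℕ → X) : Set X :=
  {y | ∃ a : ℕ → ℂ, seqENorm (Real.conjExponent p) a ≤ 1 ∧ HasSum (fun n => a n • x n) y}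

/-- Relatively `p`-compact sets. -/
def IsRelPCompact {X : Type*} [NormedAddCommGroup X] [NormedSpace ℂ X] (p : ℝ) (K : Set X) :
    Prop :=
  ∃ x ∈ pSummable p X, K ⊆ pConv p x

/-- Relatively unconditionally `p`-compact sets. -/
def IsRelUPCompact {X : Type*} [NormedAddCommGroup X] [NormedSpace ℂ X] (p : ℝ) (K : Set X) :
    Prop :=
  ∃ x ∈ unconditionallyPSummable p X, K ⊆ pConv p x

/-- The measure `m_{K_p}(K)` of the size of the `p`-compactness of `K`. -/
def measureKp {X : Type*} [NormedAddCommGroup X] [NormedSpace ℂ X] (p : ℝ) (K : Set X) : ℝ≥0∞ :=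
  sInf {r | ∃ x ∈ pSummable p X, K ⊆ pConv p x ∧ r = seqENorm p x}

/-- The measure `m_{K_up}(K)` of the size of the unconditional `p`-compactness of `K`. -/
def measureKup {X : Type*} [NormedAddCommGroup X] [NormedSpace ℂ X] (p : ℝ) (K : Set X) : ℝ≥0∞ :=
  sInf {r | ∃ x ∈ unconditionallyPSummable p X, K ⊆ pConv p x ∧ r = weakSeqENorm p x}

/-! ### Quasi `p`-nuclear and quasi unconditionally `p`-nuclear operators -/

/-- Quasi `p`-nuclear operators. -/
def IsQuasiPNuclear {X Y : Type*} [NormedAddCommGroup X] [NormedSpace ℂ X]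
    [NormedAddCommGroup Y] [NormedSpace ℂ Y] (p : ℝ) (T : X →L[ℂ] Y) : Prop :=
  ∃ φ ∈ pSummable p (StrongDual ℂ X), ∀ x, ‖T x‖ₑ ≤ seqENorm p (fun n => φ n x)

/-- Quasi unconditionally `p`-nuclear operators. -/
def IsQuasiUPNuclear {X Y : Type*} [NormedAddCommGroup X] [NormedSpace ℂ X]
    [NormedAddCommGroup Y] [NormedSpace ℂ Y] (p : ℝ) (T : X →L[ℂ] Y) : Prop :=
  ∃ φ ∈ unconditionallyPSummable p (StrongDual ℂ X),
    ∀ x, ‖T x‖ₑ ≤ seqENorm p (fun n => φ n x)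

/-- The quasi `p`-nuclear norm. -/
def normQNp {X Y : Type*} [NormedAddCommGroup X] [NormedSpace ℂ X]
    [NormedAddCommGroup Y] [NormedSpace ℂ Y] (p : ℝ) (T : X →L[ℂ] Y) : ℝ≥0∞ :=
  sInf {r | ∃ φ ∈ pSummable p (StrongDual ℂ X),
    (∀ x, ‖T x‖ₑ ≤ seqENorm p (fun n => φ n x)) ∧ r = seqENorm p φ}

/-- The quasi unconditionally `p`-nuclear norm. -/
def normQNup {X Y : Type*} [NormedAddCommGroup X] [NormedSpace ℂ X]
    [NormedAddCommGroup Y] [NormedSpace ℂ Y] (p : ℝ) (T : X →L[ℂ] Y) : ℝ≥0∞ :=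
  sInf {r | ∃ φ ∈ unconditionallyPSummable p (StrongDual ℂ X),
    (∀ x, ‖T x‖ₑ ≤ seqENorm p (fun n => φ n x)) ∧ r = weakSeqENorm p φ}

/-! ### Weighted holomorphic mappings -/

/-- A weight on an open set: a strictly positive continuous function. -/
structure Weight {E : Type*} [NormedAddCommGroup E] (U : TopologicalSpace.Opens E) where
  toFun : U → ℝ
  continuous_toFun : Continuous toFun
  pos : ∀ x, 0 < toFun x

/-- Holomorphic mappings on an open subset of a complex normed space: mappings which are complex
Fréchet differentiable on `U`. -/
def IsHolomorphic {E F : Type*} [NormedAddCommGroup E] [NormedSpace ℂ E]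
    [NormedAddCommGroup F] [NormedSpace ℂ F] {U : TopologicalSpace.Opens E} (f : U → F) : Prop :=
  ∃ g : E → F, DifferentiableOn ℂ g U ∧ ∀ x : U, g x = f x

section WeightedHolomorphic

variable {E : Type*} [NormedAddCommGroup E] [NormedSpace ℂ E] {U : TopologicalSpace.Opens E}
variable (v : Weight U) (F : Type*) [NormedAddCommGroup F] [NormedSpace ℂ F]

/-- The vector space of holomorphic `f : U → F` with `sup v(x) ‖f(x)‖ < ∞`. -/
def weightedHolSubmodule : Submodule ℂ (U → F) where
  carrier := {f | IsHolomorphic f ∧ BddAbove (Set.range fun x => v.toFun x * ‖f x‖)}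
  add_mem' := by
    rintro f g ⟨⟨f', hf', hff⟩, ⟨A, hA⟩⟩ ⟨⟨g', hg', hgg⟩, ⟨B, hB⟩⟩
    refine ⟨⟨f' + g', hf'.add hg', fun x => by simp [hff, hgg]⟩, ⟨A + B, ?_⟩⟩
    rintro _ ⟨x, rfl⟩
    have h1 := hA ⟨x, rfl⟩
    have h2 := hB ⟨x, rfl⟩
    have h3 := mul_le_mul_of_nonneg_left (norm_add_le (f x) (g x)) (v.pos x).le
    simp only [Pi.add_apply] at *
    linarith
  zero_mem' := by
    refine ⟨⟨0, differentiableOn_const 0, fun x => rfl⟩, ⟨0, ?_⟩⟩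
    rintro _ ⟨x, rfl⟩
    simp
  smul_mem' := by
    rintro c f ⟨⟨f', hf', hff⟩, ⟨A, hA⟩⟩
    refine ⟨⟨c • f', hf'.const_smul c, fun x => by simp [hff]⟩, ⟨‖c‖ * A, ?_⟩⟩
    rintro _ ⟨x, rfl⟩
    have h1 := mul_le_mul_of_nonneg_left (hA ⟨x, rfl⟩) (norm_nonneg c)
    simp only [Pi.smul_apply, norm_smul] at *
    linarith

/-- The space `H_v^∞(U, F)` of weighted holomorphic mappings. (A type of its own, so that it
carries the weighted supremum norm and not the topology of pointwise convergence.) -/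
def WeightedHol : Type _ := weightedHolSubmodule v F

instance : AddCommGroup (WeightedHol v F) := inferInstanceAs (AddCommGroup (weightedHolSubmodule v F))

instance : Module ℂ (WeightedHol v F) := inferInstanceAs (Module ℂ (weightedHolSubmodule v F))

variable {v F}

instance : CoeFun (WeightedHol v F) (fun _ => U → F) := ⟨fun f => f.1⟩

/-- The weighted supremum norm `‖f‖_v = sup {v(x) ‖f(x)‖ : x ∈ U}`. -/
instance : Norm (WeightedHol v F) := ⟨fun f => ⨆ x : U, v.toFun x * ‖f x‖⟩

theorem WeightedHol.norm_def (f : WeightedHol v F) : ‖f‖ = ⨆ x : U, v.toFun x * ‖f x‖ := rfl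

theorem WeightedHol.le_norm (f : WeightedHol v F) (x : U) : v.toFun x * ‖f x‖ ≤ ‖f‖ :=
  le_ciSup f.2.2 x

theorem WeightedHol.norm_le (f : WeightedHol v F) {C : ℝ} (hC : 0 ≤ C)
    (h : ∀ x : U, v.toFun x * ‖f x‖ ≤ C) : ‖f‖ ≤ C :=
  Real.iSup_le h hC

theorem WeightedHol.core : NormedSpace.Core ℂ (WeightedHol v F) where
  norm_nonneg f := Real.iSup_nonneg fun x => mul_nonneg (v.pos x).le (norm_nonneg _)
  norm_smul c f := by
    rw [WeightedHol.norm_def, WeightedHol.norm_def, Real.mul_iSup_of_nonneg (norm_nonneg c)]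
    congr 1
    ext x
    change v.toFun x * ‖c • f x‖ = _
    rw [norm_smul]
    ring
  norm_triangle f g := by
    refine WeightedHol.norm_le _ (add_nonneg
      (Real.iSup_nonneg fun x => mul_nonneg (v.pos x).le (norm_nonneg _))
      (Real.iSup_nonneg fun x => mul_nonneg (v.pos x).le (norm_nonneg _))) fun x => ?_
    have h1 := f.le_norm x
    have h2 := g.le_norm x
    have h3 := mul_le_mul_of_nonneg_left (norm_add_le (f x) (g x)) (v.pos x).le
    change v.toFun x * ‖f x + g x‖ ≤ _
    linarith
  norm_eq_zero_iff f := by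
    constructor
    · intro h
      refine Subtype.ext (funext fun x => ?_)
      have h1 := f.le_norm x
      rw [h] at h1
      have h2 : ‖f x‖ ≤ 0 := by
        by_contra hne
        exact absurd h1 (not_le.mpr (mul_pos (v.pos x) (not_le.mp hne)))
      exact norm_le_zero_iff.mp h2
    · rintro rfl
      rw [WeightedHol.norm_def]
      have : ∀ x : U, v.toFun x * ‖(0 : WeightedHol v F) x‖ = 0 := fun x => by
        change v.toFun x * ‖(0 : F)‖ = 0
        simp
      simp [this]

instance : NormedAddCommGroup (WeightedHol v F) := NormedAddCommGroup.ofCore WeightedHol.core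

instance : NormedSpace ℂ (WeightedHol v F) := NormedSpace.ofCore WeightedHol.core

/-- The transpose `f^t : F* → H_v^∞(U)`, `f^t(φ) = φ ∘ f`. -/
def WeightedHol.transpose (f : WeightedHol v F) : StrongDual ℂ F →L[ℂ] WeightedHol v ℂ :=
  LinearMap.mkContinuous
    { toFun := fun φ => ⟨fun x => φ (f x), by
        obtain ⟨⟨g, hg, hgf⟩, ⟨A, hA⟩⟩ := f.2
        refine ⟨⟨fun z => φ (g z), φ.differentiable.comp_differentiableOn hg,
          fun x => by simp [hgf]⟩, ⟨‖φ‖ * A, ?_⟩⟩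
        rintro _ ⟨x, rfl⟩
        have h1 := mul_le_mul_of_nonneg_left (hA ⟨x, rfl⟩) (norm_nonneg φ)
        have h2 := mul_le_mul_of_nonneg_left (φ.le_opNorm (f x)) (v.pos x).le
        simp only at *
        linarith⟩
      map_add' := fun _ _ => rfl
      map_smul' := fun _ _ => rfl }
    ‖f‖
    (fun φ => by
      refine WeightedHol.norm_le _ (mul_nonneg (WeightedHol.core.norm_nonneg f) (norm_nonneg φ))
        fun x => ?_
      have h1 := mul_le_mul_of_nonneg_left (f.le_norm x) (norm_nonneg φ)
      have h2 := mul_le_mul_of_nonneg_left (φ.le_opNorm (f x)) (v.pos x).le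
      change v.toFun x * ‖φ (f x)‖ ≤ _
      linarith)

theorem WeightedHol.transpose_apply (f : WeightedHol v F) (φ : StrongDual ℂ F) (x : U) :
    f.transpose φ x = φ (f x) := rfl

/-- The `v`-range `(vf)(U) = {v(x) f(x) : x ∈ U}`. -/
def WeightedHol.vRange (f : WeightedHol v F) : Set F :=
  Set.range fun x : U => (v.toFun x : ℂ) • f x

variable (v F)

/-- `H^∞_{vK_p}(U, F)`. -/
def WeightedHolKp (p : ℝ) : Set (WeightedHol v F) :=
  {f | IsRelPCompact p f.vRange}

/-- `H^∞_{vK_up}(U, F)`. -/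
def WeightedHolKup (p : ℝ) : Set (WeightedHol v F) :=
  {f | IsRelUPCompact p f.vRange}

variable {v F}

/-- The norm of `H^∞_{vK_p}(U, F)`. -/
def WeightedHol.normKp (p : ℝ) (f : WeightedHol v F) : ℝ≥0∞ := measureKp p f.vRange

/-- The norm of `H^∞_{vK_up}(U, F)`. -/
def WeightedHol.normKup (p : ℝ) (f : WeightedHol v F) : ℝ≥0∞ := measureKup p f.vRange

end WeightedHolomorphic

end

/-! ### Seminorm families, Hölder estimates and reindexing. -/

section UniformBounds

/-! The norm of `f.transpose φ` is the supremum of `|φ|` over the `v`-range, so the theorem concerns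
a subset of `F` only. If the `v`-range lies in the `p`-convex hull of `(x n)`, Hölder's inequality
shows that the canonical images of the `x n` in the bidual dominate the transpose, at no greater
cost.

Conversely, let `(ψ n)` in the bidual dominate the transpose. Factoring through `ℓ_p` and extending
by Hahn–Banach writes each point of the `v`-range, seen in the bidual, as `∑ a n • ψ n` with `a` in
the unit ball of `ℓ_{p*}` (`mem_pConv_of_le_seqENorm`). The difficulty is to replace the `ψ n` by
vectors of `F` at a cost exceeding the old one by arbitrarily little (`Covered.of_hellyMap`).

Up to a remainder of small cost, the coefficient sequences form a finite set. Helly's lemma then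
moves finitely many bidual vectors into `F`, with their norm bounds and finitely many approximate
sums preserved (`Covered.exists_split`). The remainder again lies in `F` and is covered in the
bidual, so the step repeats, and the pieces are glued with additive costs (`Covered.hasSum`).

Both cases run through one argument: the strong and the weak `p`-norm are suprema of `p`-norms over
a norming family of seminorms, namely the norm alone, or all `|φ|` with `‖φ‖ ≤ 1`. -/

theorem seqENorm_le_iff {X : Type*} [NormedAddCommGroup X] {p : ℝ} (hp : 0 < p) {x : ℕ → X}
    {c : ℝ≥0∞} : seqENorm p x ≤ c ↔ ∑' n, ‖x n‖ₑ ^ p ≤ c ^ p := by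
  rw [seqENorm, one_div, ENNReal.rpow_inv_le_iff hp]

variable {X ι : Type*} [NormedAddCommGroup X] [NormedSpace ℂ X]

/-- The `p`-norms of the sequences `q (x i)` are at most `c`, uniformly in `q ∈ Q`. -/
def ULpBound (Q : Set (Seminorm ℂ X)) (p : ℝ) (c : ℝ≥0∞) (x : ι → X) : Prop :=
  ∀ q ∈ Q, ∑' i, ENNReal.ofReal (q (x i)) ^ p ≤ c ^ p

open Classical in
/-- The tails of the series `∑ q (x i) ^ p` tend to zero uniformly in `q ∈ Q`. -/
def ULpTail (Q : Set (Seminorm ℂ X)) (p : ℝ) (x : ι → X) : Prop :=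
  ∀ ε : ℝ≥0∞, ε ≠ 0 → ∃ s : Finset ι, ∀ q ∈ Q,
    ∑' i, (if i ∈ s then 0 else ENNReal.ofReal (q (x i)) ^ p) ≤ ε

/-- The seminorms in `Q` are dominated by the norm, and the norm is attained on `Q` pointwise. -/
structure IsNorming (Q : Set (Seminorm ℂ X)) : Prop where
  le_norm : ∀ q ∈ Q, ∀ x, q x ≤ ‖x‖
  exists_norm_le : ∀ x, ∃ q ∈ Q, ‖x‖ ≤ q x

/-- The family `y` lies in the `p`-convex hull of a sequence controlled by `Q` and `c`. -/
def Covered {I : Type*} (Q : Set (Seminorm ℂ X)) (p : ℝ) (y : I → X) (c : ℝ≥0∞) : Prop :=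
  ∃ x : ℕ → X, ULpBound Q p c x ∧ ULpTail Q p x ∧ ∀ i, y i ∈ pConv p x

theorem ofReal_seminorm_smul (q : Seminorm ℂ X) (a : ℂ) (x : X) :
    ENNReal.ofReal (q (a • x)) = ‖a‖ₑ * ENNReal.ofReal (q x) := by
  rw [map_smul_eq_mul, ENNReal.ofReal_mul (norm_nonneg a), ofReal_norm]

theorem ofReal_seminorm_sum_le (q : Seminorm ℂ X) (s : Finset ι) (x : ι → X) :
    ENNReal.ofReal (q (∑ i ∈ s, x i)) ≤ ∑ i ∈ s, ENNReal.ofReal (q (x i)) := by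
  classical
  induction s using Finset.induction_on with
  | empty => simp
  | insert i s hi ih =>
    rw [Finset.sum_insert hi, Finset.sum_insert hi]
    calc ENNReal.ofReal (q (x i + ∑ i ∈ s, x i))
        ≤ ENNReal.ofReal (q (x i) + q (∑ i ∈ s, x i)) :=
          ENNReal.ofReal_le_ofReal (map_add_le_add q _ _)
      _ ≤ _ := ENNReal.ofReal_add_le
      _ ≤ _ := by gcongr

theorem ofReal_seminorm_sum_smul_le {p p' : ℝ} (h : p.HolderConjugate p') (q : Seminorm ℂ X)
    (s : Finset ι) (a : ι → ℂ) (x : ι → X) :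
    ENNReal.ofReal (q (∑ i ∈ s, a i • x i)) ≤
      (∑ i ∈ s, ‖a i‖ₑ ^ p') ^ (1 / p') * (∑ i ∈ s, ENNReal.ofReal (q (x i)) ^ p) ^ (1 / p) := by
  refine (ofReal_seminorm_sum_le q s _).trans ?_
  simp only [ofReal_seminorm_smul]
  exact ENNReal.inner_le_Lp_mul_Lq s _ _ h.symm

/-- Hölder for each seminorm, applied to the one that attains the norm of the sum. -/
theorem enorm_sum_smul_le {Q : Set (Seminorm ℂ X)} (hQ : IsNorming Q) {p p' : ℝ}
    (h : p.HolderConjugate p') {s : Finset ι} {a : ι → ℂ} {x : ι → X} {c : ℝ≥0∞}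
    (ha : ∑ i ∈ s, ‖a i‖ₑ ^ p' ≤ 1)
    (hx : ∀ q ∈ Q, ∑ i ∈ s, ENNReal.ofReal (q (x i)) ^ p ≤ c ^ p) :
    ‖∑ i ∈ s, a i • x i‖ₑ ≤ c := by
  obtain ⟨q, hq, hqx⟩ := hQ.exists_norm_le (∑ i ∈ s, a i • x i)
  rw [← ofReal_norm]
  refine (ENNReal.ofReal_le_ofReal hqx).trans ((ofReal_seminorm_sum_smul_le h q s a x).trans ?_)
  calc _ ≤ 1 * (c ^ p) ^ (1 / p) := by
        gcongr
        · exact ENNReal.rpow_le_one ha (one_div_nonneg.2 h.symm.nonneg)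
        · exact one_div_nonneg.2 h.nonneg
        · exact hx q hq
    _ = c := by rw [one_mul, one_div, ENNReal.rpow_rpow_inv h.ne_zero]

theorem ULpBound.mono {Q : Set (Seminorm ℂ X)} {p : ℝ} (hp : 0 ≤ p) {c d : ℝ≥0∞} {x : ι → X}
    (hx : ULpBound Q p c x) (h : c ≤ d) : ULpBound Q p d x :=
  fun q hq => (hx q hq).trans (by gcongr)

theorem Covered.mono {I : Type*} {Q : Set (Seminorm ℂ X)} {p : ℝ} (hp : 0 ≤ p) {c d : ℝ≥0∞}
    {y : I → X} (hy : Covered Q p y c) (h : c ≤ d) : Covered Q p y d := by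
  obtain ⟨x, hx, ht, hy⟩ := hy
  exact ⟨x, hx.mono hp h, ht, hy⟩

open Classical in
theorem sum_le_tsum_ite (f : ι → ℝ≥0∞) {s t : Finset ι} (h : Disjoint t s) :
    ∑ i ∈ t, f i ≤ ∑' i, (if i ∈ s then 0 else f i) := by
  calc ∑ i ∈ t, f i = ∑ i ∈ t, (if i ∈ s then 0 else f i) :=
        Finset.sum_congr rfl fun i hi => by rw [if_neg (Finset.disjoint_left.1 h hi)]
    _ ≤ _ := ENNReal.sum_le_tsum t

/-- Uniformly small tails make the finite partial sums Cauchy in norm, by Hölder. -/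
theorem ULpTail.summable_smul [CompleteSpace X] {Q : Set (Seminorm ℂ X)} (hQ : IsNorming Q)
    {p p' : ℝ} (h : p.HolderConjugate p') {x : ι → X} (hx : ULpTail Q p x) {a : ι → ℂ}
    (ha : ∑' i, ‖a i‖ₑ ^ p' ≤ 1) : Summable fun i => a i • x i := by
  rw [summable_iff_vanishing_norm]
  intro ε hε
  have hε2 : ENNReal.ofReal (ε / 2) ≠ 0 := by simpa using hε
  obtain ⟨s, hs⟩ := hx (ENNReal.ofReal (ε / 2) ^ p)
    (by simp [ENNReal.rpow_eq_zero_iff, hε])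
  refine ⟨s, fun t ht => ?_⟩
  have h1 : ‖∑ i ∈ t, a i • x i‖ₑ ≤ ENNReal.ofReal (ε / 2) :=
    enorm_sum_smul_le hQ h ((ENNReal.sum_le_tsum t).trans ha)
      fun q hq => (sum_le_tsum_ite _ ht).trans (hs q hq)
  rw [← ofReal_norm, ENNReal.ofReal_le_ofReal_iff (by positivity)] at h1
  linarith

theorem enorm_le_of_mem_pConv {Q : Set (Seminorm ℂ X)} (hQ : IsNorming Q) {p : ℝ} (hp : 1 < p)
    {x : ℕ → X} {c : ℝ≥0∞} (hx : ULpBound Q p c x) {y : X} (hy : y ∈ pConv p x) : ‖y‖ₑ ≤ c := by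
  obtain ⟨a, ha, hs⟩ := hy
  have h := Real.HolderConjugate.conjExponent hp
  rw [seqENorm_le_iff h.symm.pos, ENNReal.one_rpow] at ha
  refine le_of_tendsto (hs.enorm) (Eventually.of_forall fun s => ?_)
  exact enorm_sum_smul_le hQ h ((ENNReal.sum_le_tsum s).trans ha)
    fun q hq => (ENNReal.sum_le_tsum s).trans (hx q hq)

theorem Function.Injective.apply_extend_zero {α β γ δ : Type*} [Zero β] [Zero γ] {e : α → δ}
    (he : Function.Injective e) (g : δ → β → γ) (hg : ∀ d, g d 0 = 0) (f : α → β) :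
    (fun d => g d (Function.extend e f 0 d)) = Function.extend e (fun a => g (e a) (f a)) 0 := by
  funext d
  by_cases hd : ∃ a, e a = d
  · obtain ⟨a, rfl⟩ := hd
    simp only [he.extend_apply]
  · simp only [Function.extend_apply' _ _ _ hd, Pi.zero_apply, hg]

open Classical in
-- Embed the index set in `ℕ` and extend by zero. Later constructions may thus use pairs or finite
-- types as indices.
theorem Covered.of_countable {I : Type*} {κ : Type*} [Countable κ] {Q : Set (Seminorm ℂ X)}
    {p : ℝ} (hp : 1 < p) {c : ℝ≥0∞} {y : I → X} {x : κ → X} (hx : ULpBound Q p c x)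
    (ht : ULpTail Q p x)
    (h : ∀ i, ∃ a : κ → ℂ, ∑' k, ‖a k‖ₑ ^ p.conjExponent ≤ 1 ∧
      HasSum (fun k => a k • x k) (y i)) : Covered Q p y c := by
  obtain ⟨e, he⟩ := exists_injective_nat κ
  have hpq := Real.HolderConjugate.conjExponent hp
  have hp0 : 0 < p := hpq.pos
  refine ⟨Function.extend e x 0, fun q hq => ?_, fun ε hε => ?_, fun i => ?_⟩
  · rw [he.apply_extend_zero (fun _ z => ENNReal.ofReal (q z) ^ p) (by simp [hp0]) x,
      tsum_extend_zero he]
    exact hx q hq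
  · obtain ⟨s, hs⟩ := ht ε hε
    refine ⟨s.image e, fun q hq => ?_⟩
    have h1 := he.apply_extend_zero
      (fun n z => if n ∈ s.image e then 0 else ENNReal.ofReal (q z) ^ p) (by simp [hp0]) x
    have h2 : ∑' n, (if n ∈ s.image e then 0 else
        ENNReal.ofReal (q (Function.extend e x 0 n)) ^ p) ≤ ε := by
      rw [h1, tsum_extend_zero he]
      simpa [he.eq_iff] using hs q hq
    convert h2
  · obtain ⟨a, ha, hs⟩ := h i
    refine ⟨Function.extend e a 0, ?_, ?_⟩
    · rw [seqENorm_le_iff hpq.symm.pos, ENNReal.one_rpow,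
        he.apply_extend_zero (fun _ z => ‖z‖ₑ ^ p.conjExponent) (by simp [hpq.symm.pos]) a,
        tsum_extend_zero he]
      exact ha
    · rw [he.apply_extend_zero (fun n z => z • Function.extend e x 0 n) (by simp) a]
      simp only [he.extend_apply]
      rwa [hasSum_extend_zero he]

theorem exists_pos_ofReal_rpow_eq {w : ℝ≥0∞} (h0 : w ≠ 0) (ht : w ≠ ∞) {p : ℝ} (hp : 0 < p) :
    ∃ s : ℝ, 0 < s ∧ ENNReal.ofReal s ^ p = w := by
  have hw := ENNReal.toReal_pos h0 ht
  refine ⟨w.toReal ^ (1 / p), by positivity, ?_⟩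
  rw [ENNReal.ofReal_rpow_of_nonneg (by positivity) hp.le, ← Real.rpow_mul hw.le,
    one_div_mul_cancel hp.ne', Real.rpow_one, ENNReal.ofReal_toReal ht]

/-- With the weight `S`, a block of cost `c` contributes `C ^ (p - 1) * c`; over costs of total `C`
this adds up to `C ^ p`. -/
theorem inv_rpow_mul_rpow {p p' : ℝ} (h : p.HolderConjugate p') {S c C : ℝ≥0∞} (hc : c ≠ 0)
    (hc' : c ≠ ∞) (hS : S ^ p' = c / C) : S⁻¹ ^ p * c ^ p = C ^ (p - 1) * c := by
  have hS' : S = (c / C) ^ (1 / p') := by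
    rw [← hS, one_div, ENNReal.rpow_rpow_inv h.symm.ne_zero]
  have he : 1 / p' * p = p - 1 := by
    have h1 := h.sub_one_mul_conj
    have h2 := h.symm.ne_zero
    field_simp
    linarith
  rw [ENNReal.inv_rpow, hS', ← ENNReal.rpow_mul, he, ← ENNReal.inv_rpow, ENNReal.inv_div
    (Or.inr hc') (Or.inr hc), ENNReal.div_rpow_of_nonneg _ _ h.sub_one_pos.le, div_eq_mul_inv,
    mul_assoc]
  congr 1
  have h3 : c ^ p = c ^ (p - 1) * c := by
    nth_rewrite 3 [← ENNReal.rpow_one c]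
    rw [← ENNReal.rpow_add _ _ hc hc']
    ring_nf
  rw [h3, ← mul_assoc, ENNReal.inv_mul_cancel, one_mul]
  · simp [hc, hc', ENNReal.rpow_eq_zero_iff]
  · exact ENNReal.rpow_ne_top_of_nonneg h.sub_one_pos.le hc'

end UniformBounds

/-! ### Gluing countably many covers with additive costs. -/

section CountableSums

variable {X : Type*} [NormedAddCommGroup X] [NormedSpace ℂ X]

open Classical in
theorem tsum_ite_mem_zero {ι : Type*} (f : ι → ℝ≥0∞) (s : Finset ι) :
    ∑' i, (if i ∈ s then 0 else f i) = ∑' i : {i // i ∉ s}, f i := by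
  refine Eq.trans (tsum_congr fun i => ?_) (tsum_subtype {i | i ∉ s} f).symm
  by_cases hi : i ∈ s <;> simp [hi]

/-- Juxtaposing the sequences unweighted would not give cost `∑ c k`. Dividing block `k` by `s k`
and multiplying its coefficients by `s k` does, when `s k ^ p* = c k / C`. -/
theorem Covered.hasSum [CompleteSpace X] {I κ : Type*} [Countable κ] {Q : Set (Seminorm ℂ X)}
    (hQ : IsNorming Q) {p : ℝ} (hp : 1 < p) {c : κ → ℝ≥0∞} {y : κ → I → X} {z : I → X}
    (hc0 : ∀ k, c k ≠ 0) (hC : ∑' k, c k ≠ ∞) (hy : ∀ k, Covered Q p (y k) (c k))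
    (hz : ∀ i, HasSum (fun k => y k i) (z i)) : Covered Q p z (∑' k, c k) := by
  classical
  have h := Real.HolderConjugate.conjExponent hp
  set C := ∑' k, c k
  have hc : ∀ k, c k ≠ ∞ := ENNReal.ne_top_of_tsum_ne_top hC
  have hcC : ∀ k, c k ≤ C := fun k => ENNReal.le_tsum k
  have hw : ∀ k, ∃ s : ℝ, 0 < s ∧ ENNReal.ofReal s ^ p.conjExponent = c k / C := fun k =>
    exists_pos_ofReal_rpow_eq (ENNReal.div_ne_zero.2 ⟨hc0 k, hC⟩)
      (ENNReal.div_ne_top (hc k) fun h0 => hc0 k (le_zero_iff.1 (h0 ▸ hcC k))) h.symm.pos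
  choose s hs0 hs using hw
  choose x hxb hxt hxy using hy
  choose a ha hax using hxy
  have hnorm : ∀ k, ‖(s k : ℂ)‖ₑ = ENNReal.ofReal (s k) := fun k => by
    rw [← ofReal_norm, Complex.norm_real, Real.norm_of_nonneg (hs0 k).le]
  have hterm : ∀ (q : Seminorm ℂ X) k n,
      ENNReal.ofReal (q ((s k : ℂ)⁻¹ • x k n)) ^ p =
        (ENNReal.ofReal (s k))⁻¹ ^ p * ENNReal.ofReal (q (x k n)) ^ p := fun q k n => by
    rw [ofReal_seminorm_smul, ENNReal.mul_rpow_of_nonneg _ _ h.nonneg, enorm_inv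
      (by exact_mod_cast (hs0 k).ne'), hnorm]
  have hblock : ∀ q ∈ Q, ∀ k, ∑' n, ENNReal.ofReal (q ((s k : ℂ)⁻¹ • x k n)) ^ p ≤
      C ^ (p - 1) * c k := fun q hq k => by
    simp only [hterm]
    rw [ENNReal.tsum_mul_left, ← inv_rpow_mul_rpow h (hc0 k) (hc k) (hs k)]
    gcongr
    exact hxb k q hq
  suffices hT : ULpBound Q p C (fun j : κ × ℕ => (s j.1 : ℂ)⁻¹ • x j.1 j.2) ∧
      ULpTail Q p (fun j : κ × ℕ => (s j.1 : ℂ)⁻¹ • x j.1 j.2) by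
    refine Covered.of_countable hp hT.1 hT.2 fun i => ?_
    have hsa : ∀ k, ∑' n, ‖(s k : ℂ) * a k i n‖ₑ ^ p.conjExponent ≤ c k / C := fun k => by
      have h1 := ha k i
      rw [seqENorm_le_iff h.symm.pos, ENNReal.one_rpow] at h1
      simp only [enorm_mul, hnorm, ENNReal.mul_rpow_of_nonneg _ _ h.symm.nonneg, hs]
      rw [ENNReal.tsum_mul_left]
      exact mul_le_of_le_one_right' h1
    have hsa' : ∑' j : κ × ℕ, ‖(s j.1 : ℂ) * a j.1 i j.2‖ₑ ^ p.conjExponent ≤ 1 := by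
      rw [ENNReal.tsum_prod']
      calc _ ≤ ∑' k, c k / C := ENNReal.tsum_le_tsum hsa
        _ = C / C := by simp only [div_eq_mul_inv]; rw [ENNReal.tsum_mul_right]
        _ ≤ 1 := ENNReal.div_self_le_one
    refine ⟨fun j => (s j.1 : ℂ) * a j.1 i j.2, hsa', ?_⟩
    have hS := (hT.2.summable_smul hQ h hsa').hasSum
    have hF : ∀ k, HasSum (fun n => ((s k : ℂ) * a k i n) • ((s k : ℂ)⁻¹ • x k n)) (y k i) := by
      intro k
      convert hax k i using 2 with n
      have : (s k : ℂ) ≠ 0 := by exact_mod_cast (hs0 k).ne'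
      rw [smul_smul, mul_right_comm, mul_inv_cancel₀ this, one_mul]
    -- The double series converges unconditionally; summing it block by block identifies its value.
    rwa [(hS.prod_fiberwise hF).unique (hz i)] at hS
  refine ⟨fun q hq => ?_, fun ε hε => ?_⟩
  · rw [ENNReal.tsum_prod']
    calc _ ≤ ∑' k, C ^ (p - 1) * c k := ENNReal.tsum_le_tsum fun k => hblock q hq k
      _ = C ^ (p - 1) * C ^ (1 : ℝ) := by rw [ENNReal.tsum_mul_left, ENNReal.rpow_one]
      _ = C ^ p := by
        rw [← ENNReal.rpow_add_of_nonneg _ _ h.sub_one_pos.le zero_le_one, sub_add_cancel]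
  · have hε2 : ε / 2 ≠ 0 := by simpa using hε
    have hsum : ∑' k, C ^ (p - 1) * c k ≠ ∞ := by
      rw [ENNReal.tsum_mul_left]
      exact ENNReal.mul_ne_top (ENNReal.rpow_ne_top_of_nonneg h.sub_one_pos.le hC) hC
    -- Half of `ε` pays for all blocks outside `σ`, the other half for the tails inside the blocks
    -- of `σ`.
    obtain ⟨σ, hσ⟩ : ∃ σ : Finset κ, ∑' k : {k // k ∉ σ}, C ^ (p - 1) * c k < ε / 2 :=
      ((tendsto_order.1 (ENNReal.tendsto_tsum_compl_atTop_zero hsum)).2 _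
        (pos_iff_ne_zero.2 hε2)).exists
    obtain ⟨δ, hδ0, hδ⟩ := ENNReal.exists_pos_sum_of_countable hε2 κ
    have htail : ∀ k, ∃ t : Finset ℕ, ∀ q ∈ Q,
        ∑' n, (if n ∈ t then 0 else ENNReal.ofReal (q (x k n)) ^ p) ≤
          δ k / (ENNReal.ofReal (s k))⁻¹ ^ p := fun k => by
      obtain ⟨t, ht⟩ := hxt k (δ k / (ENNReal.ofReal (s k))⁻¹ ^ p)
        (ENNReal.div_ne_zero.2 ⟨by exact_mod_cast (hδ0 k).ne',
          ENNReal.rpow_ne_top_of_nonneg h.nonneg (by simp [hs0 k])⟩)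
      exact ⟨t, fun q hq => by convert ht q hq⟩
    choose t ht using htail
    refine ⟨σ ×ˢ σ.biUnion t, fun q hq => ?_⟩
    rw [ENNReal.tsum_prod']
    have hk : ∀ k, ∑' n, (if (k, n) ∈ σ ×ˢ σ.biUnion t then 0 else
        ENNReal.ofReal (q ((s k : ℂ)⁻¹ • x k n)) ^ p) ≤
        δ k + (if k ∈ σ then 0 else C ^ (p - 1) * c k) := fun k => by
      by_cases hkσ : k ∈ σ
      · rw [if_pos hkσ, add_zero]
        calc _ ≤ ∑' n, (ENNReal.ofReal (s k))⁻¹ ^ p *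
              (if n ∈ t k then 0 else ENNReal.ofReal (q (x k n)) ^ p) := by
              refine ENNReal.tsum_le_tsum fun n => ?_
              by_cases hn : n ∈ t k
              · have : (k, n) ∈ σ ×ˢ σ.biUnion t :=
                  Finset.mem_product.2 ⟨hkσ, Finset.mem_biUnion.2 ⟨k, hkσ, hn⟩⟩
                rw [if_pos this]
                exact zero_le
              · rw [if_neg hn, ← hterm]
                split_ifs
                · exact zero_le
                · exact le_rfl
          _ ≤ (ENNReal.ofReal (s k))⁻¹ ^ p * (δ k / (ENNReal.ofReal (s k))⁻¹ ^ p) := by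
              rw [ENNReal.tsum_mul_left]
              gcongr
              exact ht k q hq
          _ ≤ δ k := ENNReal.mul_div_le
      · rw [if_neg hkσ]
        refine le_add_left (le_trans (ENNReal.tsum_le_tsum fun n => ?_) (hblock q hq k))
        split_ifs
        · exact zero_le
        · exact le_rfl
    have hσ' : ∑' k, (if k ∈ σ then 0 else C ^ (p - 1) * c k) ≤ ε / 2 := by
      refine le_of_eq_of_le ?_ hσ.le
      convert tsum_ite_mem_zero _ σ
    calc _ ≤ ∑' k, (δ k + (if k ∈ σ then 0 else C ^ (p - 1) * c k) : ℝ≥0∞) := by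
          refine le_trans (le_of_eq ?_) (ENNReal.tsum_le_tsum hk)
          refine tsum_congr fun k => tsum_congr fun n => ?_
          split_ifs <;> rfl
      _ ≤ ε / 2 + ε / 2 := by
          rw [ENNReal.tsum_add]
          gcongr
      _ = ε := ENNReal.add_halves ε

theorem Covered.zero {I : Type*} {Q : Set (Seminorm ℂ X)} {p : ℝ} (hp : 1 < p) (c : ℝ≥0∞) :
    Covered Q p (0 : I → X) c := by
  have h := Real.HolderConjugate.conjExponent hp
  refine ⟨0, fun q _ => by simp [h.pos], fun ε _ => ⟨∅, fun q _ => by simp [h.pos]⟩, fun i =>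
    ⟨0, ?_, ?_⟩⟩
  · simp [seqENorm, h.symm.pos]
  · simp

theorem Covered.add [CompleteSpace X] {I : Type*} {Q : Set (Seminorm ℂ X)} (hQ : IsNorming Q)
    {p : ℝ} (hp : 1 < p) {y z : I → X} {c d : ℝ≥0∞} (hy : Covered Q p y c) (hz : Covered Q p z d)
    (hc0 : c ≠ 0) (hc : c ≠ ∞) (hd0 : d ≠ 0) (hd : d ≠ ∞) : Covered Q p (y + z) (c + d) := by
  have := Covered.hasSum (κ := Bool) hQ hp (c := fun b => cond b c d) (y := fun b => cond b y z)
    (z := y + z) (by simp [hc0, hd0]) (by simp [hc, hd]) (by simp [hy, hz])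
    (fun i => by simpa using hasSum_fintype fun b : Bool => (cond b y z) i)
  simpa using this

end CountableSums

/-! ### Helly's lemma and the transfer of norm bounds. -/

section Helly

variable {X : Type*} [NormedAddCommGroup X] [NormedSpace ℂ X]

theorem exists_norm_lt_apply_eq (h : StrongDual ℂ X) {ρ r : ℝ} (hρ : 0 ≤ ρ) (hr : ρ < r) :
    ∃ e : X, ‖e‖ < r ∧ h e = ((ρ * ‖h‖ : ℝ) : ℂ) := by
  have hr0 : 0 < r := hρ.trans_lt hr
  rcases eq_or_ne h 0 with rfl | hne
  · exact ⟨0, by simpa using hr0, by simp⟩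
  have hn : 0 < ‖h‖ := norm_pos_iff.2 hne
  have h1 : ρ / r * ‖h‖ < ‖h‖ := mul_lt_of_lt_one_left hn ((div_lt_one hr0).2 hr)
  obtain ⟨x, hx1, hx⟩ := h.exists_lt_apply_of_lt_opNorm h1
  have hx0 : 0 < ‖h x‖ := lt_of_le_of_lt (by positivity) hx
  refine ⟨(((ρ * ‖h‖ : ℝ) : ℂ) / h x) • x, ?_, ?_⟩
  · rw [norm_smul, norm_div, Complex.norm_real, Real.norm_of_nonneg (by positivity)]
    have h2 : ρ * ‖h‖ / ‖h x‖ < r := by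
      rw [div_lt_iff₀ hx0]
      rw [div_mul_eq_mul_div, div_lt_iff₀ hr0] at hx
      linarith
    calc _ ≤ ρ * ‖h‖ / ‖h x‖ * 1 := by gcongr
      _ < r := by rwa [mul_one]
  · rw [map_smul, smul_eq_mul, div_mul_cancel₀ _ (norm_pos_iff.1 hx0)]

/-- Helly's lemma: finitely many strict norm inequalities satisfied by vectors of the bidual
can be satisfied by vectors of the space itself. -/
theorem exists_norm_sum_smul_sub_lt {J ι : Type*} [Fintype J] (s : Finset ι) (c : J → ι → ℂ)
    (ψ : ι → StrongDual ℂ (StrongDual ℂ X)) (y : J → X) (r : J → ℝ)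
    (h : ∀ j, ‖∑ n ∈ s, c j n • ψ n - NormedSpace.inclusionInDoubleDual ℂ X (y j)‖ < r j) :
    ∃ x : ι → X, ∀ j, ‖∑ n ∈ s, c j n • x n - y j‖ < r j := by
  classical
  by_contra! hcon
  -- If no `x` works, the range of `A` misses the product of balls `B`, and Hahn–Banach separates
  -- them.
  let A : (ι → X) →ₗ[ℂ] (J → X) := LinearMap.pi fun j => ∑ n ∈ s, c j n • LinearMap.proj n
  have hA : ∀ x j, A x j = ∑ n ∈ s, c j n • x n := fun x j => by simp [A]
  let B : Set (J → X) := Set.univ.pi fun j => Metric.ball (y j) (r j)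
  have hB1 : Convex ℝ B := convex_pi fun j _ => convex_ball _ _
  have hB2 : IsOpen B := isOpen_set_pi Set.finite_univ fun j _ => Metric.isOpen_ball
  have hdisj : Disjoint B (LinearMap.range A : Set (J → X)) := by
    rw [Set.disjoint_left]
    rintro _ hb ⟨x, rfl⟩
    obtain ⟨j, hj⟩ := hcon x
    have := hb j (Set.mem_univ j)
    rw [Metric.mem_ball, dist_eq_norm, hA] at this
    linarith
  obtain ⟨f, u, hfB, hfA⟩ := RCLike.geometric_hahn_banach_open (𝕜 := ℂ) hB1 hB2
    ((LinearMap.range A).restrictScalars ℝ).convex hdisj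
  have hu : u ≤ 0 := by simpa using hfA 0 (LinearMap.range A).zero_mem
  -- The real part of `f` is bounded below on a complex subspace, so rescaling forces `f` to vanish
  -- there.
  have hfA0 : ∀ x, f (A x) = 0 := by
    intro x
    by_contra hne
    have h1 := hfA (A (((u - 1 : ℝ) / f (A x) : ℂ) • x)) ⟨_, rfl⟩
    rw [map_smul, map_smul, smul_eq_mul, div_mul_cancel₀ _ hne] at h1
    simp at h1
    linarith
  let g : J → StrongDual ℂ X := fun j => f.comp (ContinuousLinearMap.single ℂ (fun _ => X) j)
  have hg : ∀ z, f z = ∑ j, g j (z j) := fun z => by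
    conv_lhs => rw [← Finset.univ_sum_single z]
    rw [map_sum]
    rfl
  -- Vanishing on the range becomes a linear relation between functionals, to which each `ψ n` can
  -- be applied.
  have hcg : ∀ n ∈ s, ∑ j, c j n • g j = 0 := by
    intro n hn
    ext x
    have h1 := hfA0 (Pi.single n x)
    rw [hg] at h1
    simp only [hA] at h1
    refine Eq.trans ?_ h1
    rw [_root_.sum_apply]
    refine Finset.sum_congr rfl fun j _ => ?_
    rw [Finset.sum_eq_single n (fun m _ hm => by simp [hm]) (fun h => absurd hn h)]
    simp
  let w : J → StrongDual ℂ (StrongDual ℂ X) := fun j => ∑ n ∈ s, c j n • ψ n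
  have hw : ∑ j, w j (g j) = 0 := by
    have : ∀ j, w j (g j) = ∑ n ∈ s, ψ n (c j n • g j) := fun j => by
      simp [w]
    simp only [this]
    rw [Finset.sum_comm]
    refine Finset.sum_eq_zero fun n hn => ?_
    rw [← map_sum, hcg n hn, map_zero]
  -- The point `y + e` lies in `B`, yet `e` is large enough on each `g j` to make the real part of
  -- `f (y + e)` nonnegative.
  choose e he1 he2 using fun j => exists_norm_lt_apply_eq (g j)
    (norm_nonneg (w j - NormedSpace.inclusionInDoubleDual ℂ X (y j))) (h j)
  have h1 : (f (y + e)).re < 0 := by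
    refine lt_of_lt_of_le (hfB _ fun j _ => ?_) hu
    simpa [Metric.mem_ball, dist_eq_norm] using he1 j
  have h2 : f (y + e) = ∑ j, ((‖w j - NormedSpace.inclusionInDoubleDual ℂ X (y j)‖ * ‖g j‖ : ℝ) -
      (w j - NormedSpace.inclusionInDoubleDual ℂ X (y j)) (g j)) := by
    rw [Finset.sum_sub_distrib, hg]
    simp only [Pi.add_apply, map_add, _root_.sub_apply, NormedSpace.dual_def, he2,
      Finset.sum_add_distrib, Finset.sum_sub_distrib, hw, w]
    ring
  rw [h2, Complex.re_sum] at h1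
  refine absurd h1 (not_lt.2 (Finset.sum_nonneg fun j _ => ?_))
  rw [Complex.sub_re, Complex.ofReal_re, sub_nonneg]
  exact (Complex.re_le_norm _).trans (ContinuousLinearMap.le_opNorm _ _)

/-- The real extremiser of Hölder's inequality, with phases `t` that rotate each `u i` to its
modulus. -/
theorem exists_sum_mul_eq_Lp {ι : Type*} {p p' : ℝ} (h : p.HolderConjugate p') (s : Finset ι)
    (u : ι → ℂ) : ∃ b : ι → ℂ, ∑ i ∈ s, ‖b i‖ₑ ^ p' ≤ 1 ∧
      (∑ i ∈ s, ‖u i‖ₑ ^ p) ^ (1 / p) = ‖∑ i ∈ s, b i * u i‖ₑ := by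
  obtain ⟨g, hg1, hg⟩ := (NNReal.isGreatest_Lp s (fun i => ‖u i‖₊) h).1
  have hsgn : ∀ z : ℂ, ∃ t : ℂ, ‖t‖ = 1 ∧ t * z = ‖z‖ := fun z => by
    rcases eq_or_ne z 0 with rfl | hz
    · exact ⟨1, by simp, by simp⟩
    · have hz' : (‖z‖ : ℂ) ≠ 0 := by simpa using hz
      exact ⟨‖z‖ / z, by simp [hz], by field_simp⟩
  choose t ht1 ht using hsgn
  refine ⟨fun i => (g i : ℝ) * t (u i), ?_, ?_⟩
  · have : ∀ i, ‖((g i : ℝ) : ℂ) * t (u i)‖ₑ = g i := fun i => by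
      rw [← ofReal_norm, norm_mul, ht1, mul_one, Complex.norm_real,
        Real.norm_of_nonneg (NNReal.coe_nonneg _), ENNReal.ofReal_coe_nnreal]
    simp only [this]
    simp only [← ENNReal.coe_rpow_of_nonneg _ h.symm.nonneg]
    exact_mod_cast hg1
  · have h1 : ∑ i ∈ s, ((g i : ℝ) : ℂ) * t (u i) * u i =
        (((∑ i ∈ s, ‖u i‖₊ * g i : NNReal) : ℝ) : ℂ) := by
      push_cast
      refine Finset.sum_congr rfl fun i _ => ?_
      rw [mul_assoc, ht, mul_comm]
    rw [h1, ← ofReal_norm, Complex.norm_real, Real.norm_of_nonneg (NNReal.coe_nonneg _),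
      ENNReal.ofReal_coe_nnreal]
    simp only at hg
    rw [hg, ENNReal.coe_rpow_of_nonneg _ (one_div_nonneg.2 h.nonneg)]
    congr 1
    push_cast
    refine Finset.sum_congr rfl fun i _ => ?_
    rw [ENNReal.coe_rpow_of_nonneg _ h.nonneg, enorm_eq_nnnorm]

theorem sum_ite_smul {ι : Type*} [DecidableEq ι] {s : Finset ι} {j : ι} (hj : j ∈ s)
    (x : ι → X) : ∑ n ∈ s, (if n = j then (1 : ℂ) else 0) • x n = x j := by
  simp [hj]

variable {Y : Type*} [NormedAddCommGroup Y] [NormedSpace ℂ Y]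

/-- Bounds on finite sections for `Q''` follow, up to `δ`, from finitely many norm inequalities,
which transfer to bounds for `Q`. -/
def FinitelyTestable (Q : Set (Seminorm ℂ X)) (Q'' : Set (Seminorm ℂ Y)) (p : ℝ) : Prop :=
  ∀ (s : Finset ℕ) (ψ : ℕ → Y) (c : ℝ≥0∞), c ≠ ∞ →
    (∀ q ∈ Q'', ∑ n ∈ s, ENNReal.ofReal (q (ψ n)) ^ p ≤ c ^ p) → ∀ δ : ℝ, 0 < δ →
    ∃ (J : Type) (_ : Fintype J) (b : J → ℕ → ℂ) (r : J → ℝ),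
      (∀ j, ‖∑ n ∈ s, b j n • ψ n‖ < r j) ∧
      ∀ x : ℕ → X, (∀ j, ‖∑ n ∈ s, b j n • x n‖ < r j) →
        ∀ q ∈ Q, ∑ n ∈ s, ENNReal.ofReal (q (x n)) ^ p ≤ (c + ENNReal.ofReal δ) ^ p

/-- The norm, as the only member of a family of seminorms. -/
def strongFamily (X : Type*) [NormedAddCommGroup X] [NormedSpace ℂ X] : Set (Seminorm ℂ X) :=
  {normSeminorm ℂ X}

/-- The absolute values of the functionals in the closed unit ball of the dual. -/
def weakFamily (X : Type*) [NormedAddCommGroup X] [NormedSpace ℂ X] : Set (Seminorm ℂ X) :=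
  (fun φ : StrongDual ℂ X => (normSeminorm ℂ ℂ).comp φ.toLinearMap) '' Metric.closedBall 0 1

theorem isNorming_strongFamily : IsNorming (strongFamily X) where
  le_norm := by
    rintro q rfl x
    exact le_rfl
  exists_norm_le x := ⟨_, rfl, le_rfl⟩

theorem isNorming_weakFamily : IsNorming (weakFamily X) where
  le_norm := by
    rintro _ ⟨φ, hφ, rfl⟩ x
    exact φ.le_of_opNorm_le (by simpa using hφ) x |>.trans_eq (one_mul _)
  exists_norm_le x := by
    obtain ⟨φ, hφ, hx⟩ := exists_dual_vector'' ℂ x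
    refine ⟨_, ⟨φ, by simpa using hφ, rfl⟩, ?_⟩
    change ‖x‖ ≤ ‖φ x‖
    rw [hx]
    simp

/-- It suffices to test each vector separately, with slack `η`; Minkowski adds the slack up to at
most `card s * η`. -/
theorem finitelyTestable_strongFamily {p : ℝ} (hp : 1 < p) :
    FinitelyTestable (strongFamily X) (strongFamily Y) p := by
  classical
  intro s ψ c hc hψ δ hδ
  have hp0 : 0 < p := by linarith
  replace hψ := hψ _ rfl
  set η : ℝ := δ / (s.card + 1) with hη
  have hη0 : 0 < η := by positivity
  refine ⟨s, inferInstance, fun j n => if n = j then 1 else 0, fun j => ‖ψ j‖ + η, fun j => ?_,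
    fun x hx q hq => ?_⟩
  · simp only
    rw [sum_ite_smul j.2]
    linarith
  · obtain rfl : q = normSeminorm ℂ X := hq
    have hx' : ∀ n ∈ s, ‖x n‖ ≤ ‖ψ n‖ + η := fun n hn => by
      have := hx ⟨n, hn⟩
      simp only at this
      rw [sum_ite_smul hn] at this
      exact this.le
    have h1 : (∑ n ∈ s, ENNReal.ofReal ‖x n‖ ^ p) ^ (1 / p) ≤ c + ENNReal.ofReal δ :=
      calc _ ≤ (∑ n ∈ s, (ENNReal.ofReal ‖ψ n‖ + ENNReal.ofReal η) ^ p) ^ (1 / p) := by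
            gcongr with n hn
            rw [← ENNReal.ofReal_add (norm_nonneg _) hη0.le]
            exact ENNReal.ofReal_le_ofReal (hx' n hn)
        _ ≤ _ := ENNReal.Lp_add_le s _ _ hp.le
        _ ≤ c + ENNReal.ofReal δ := by
            gcongr
            · rw [one_div, ENNReal.rpow_inv_le_iff hp0]
              exact hψ
            · rw [Finset.sum_const, nsmul_eq_mul, ENNReal.mul_rpow_of_nonneg _ _ (by positivity),
                one_div, ENNReal.rpow_rpow_inv hp0.ne', ← one_div]
              calc _ ≤ ((s.card : ℝ≥0∞) + 1) * ENNReal.ofReal η := by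
                    gcongr
                    calc (s.card : ℝ≥0∞) ^ (1 / p) ≤ ((s.card : ℝ≥0∞) + 1) ^ (1 / p) := by
                          gcongr
                          exact le_self_add
                      _ ≤ ((s.card : ℝ≥0∞) + 1) ^ (1 : ℝ) :=
                          ENNReal.rpow_le_rpow_of_exponent_le le_add_self
                            ((div_le_one hp0).2 hp.le)
                      _ = _ := ENNReal.rpow_one _
                _ = ENNReal.ofReal ((s.card + 1) * η) := by
                    rw [ENNReal.ofReal_mul (by positivity), ENNReal.ofReal_add (by positivity)
                      zero_le_one, ENNReal.ofReal_natCast, ENNReal.ofReal_one]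
                _ = ENNReal.ofReal δ := by
                    rw [hη]
                    congr 1
                    field_simp
                _ ≤ ENNReal.ofReal δ := le_rfl
    rwa [one_div, ENNReal.rpow_inv_le_iff hp0] at h1

/-- By duality the weak norm of a finite section is the largest norm of `∑ b n • x n` over the unit
ball of `ℓ_{p*}`. A finite net of that ball suffices once the individual norms are bounded. -/
theorem finitelyTestable_weakFamily {p : ℝ} (hp : 1 < p) :
    FinitelyTestable (weakFamily X) (weakFamily Y) p := by
  classical
  intro s ψ c hc hψ δ hδ
  have h := Real.HolderConjugate.conjExponent hp
  set M : ℝ := ∑ n ∈ s, (‖ψ n‖ + 1) with hM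
  have hM0 : 0 ≤ M := Finset.sum_nonneg fun n _ => by positivity
  -- The slack on the net costs `η`, and passing from the net to the ball costs `η * M`; together
  -- they are at most `δ`.
  set η : ℝ := δ / (M + 2) with hη
  have hη0 : 0 < η := by positivity
  let K : Set (s → ℂ) := {b | ∑ n, ‖b n‖ₑ ^ p.conjExponent ≤ 1}
  have hK : TotallyBounded K := by
    refine (isCompact_closedBall (0 : s → ℂ) 1).totallyBounded.subset fun b hb => ?_
    rw [mem_closedBall_zero_iff, pi_norm_le_iff_of_nonneg zero_le_one]
    intro n
    have h1 : ‖b n‖ₑ ^ p.conjExponent ≤ 1 :=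
      (Finset.single_le_sum (f := fun n => ‖b n‖ₑ ^ p.conjExponent) (fun _ _ => zero_le)
        (Finset.mem_univ n)).trans hb
    have h2 : ‖b n‖ₑ ≤ 1 := by
      have := (ENNReal.rpow_le_rpow_iff (z := p.conjExponent) h.symm.pos).1
        (h1.trans_eq (ENNReal.one_rpow _).symm)
      exact this
    rwa [← ofReal_norm, ENNReal.ofReal_le_one] at h2
  obtain ⟨t, htK, htf, htc⟩ := Metric.finite_approx_of_totallyBounded hK _ hη0
  have : Fintype t := htf.fintype
  let ext : (s → ℂ) → ℕ → ℂ := fun b n => if hn : n ∈ s then b ⟨n, hn⟩ else 0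
  have hext : ∀ b : s → ℂ, ∀ n (hn : n ∈ s), ext b n = b ⟨n, hn⟩ := fun b n hn => dif_pos hn
  refine ⟨t ⊕ s, inferInstance, Sum.elim (fun b => ext b) (fun j n => if n = j then 1 else 0),
    Sum.elim (fun _ => c.toReal + η) (fun j => ‖ψ j‖ + 1), ?_, fun x hx q hq => ?_⟩
  · rintro (b | j)
    · simp only [Sum.elim_inl]
      have h1 : ‖∑ n ∈ s, ext b n • ψ n‖ₑ ≤ c := by
        refine enorm_sum_smul_le isNorming_weakFamily h ?_ hψ
        rw [← Finset.sum_coe_sort]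
        refine le_of_eq_of_le (Finset.sum_congr rfl fun n _ => ?_) (htK b.2)
        rw [hext _ _ n.2]
      have h2 : ‖∑ n ∈ s, ext b n • ψ n‖ ≤ c.toReal := by
        rw [← toReal_enorm]
        exact ENNReal.toReal_mono hc h1
      linarith
    · simp only [Sum.elim_inr]
      rw [sum_ite_smul j.2]
      linarith
  · obtain ⟨φ, hφ, rfl⟩ := hq
    have hφx : ∀ z, ‖φ z‖ ≤ ‖z‖ := fun z =>
      (φ.le_of_opNorm_le (by simpa using hφ) z).trans_eq (one_mul _)
    obtain ⟨b, hb1, hb⟩ := exists_sum_mul_eq_Lp h s (fun n => φ (x n))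
    have hbK : (fun n : s => b n) ∈ K := by
      change ∑ n : s, ‖b n‖ₑ ^ p.conjExponent ≤ 1
      rwa [Finset.sum_coe_sort s (fun n => ‖b n‖ₑ ^ p.conjExponent)]
    obtain ⟨b', hb't, hbb'⟩ := Set.mem_iUnion₂.1 (htc hbK)
    have h1 : ‖∑ n ∈ s, ext b' n * φ (x n)‖ ≤ c.toReal + η := by
      have := (hφx _).trans (hx (Sum.inl ⟨b', hb't⟩)).le
      simpa only [Sum.elim_inl, map_sum, map_smul, smul_eq_mul] using this
    have h2 : ‖∑ n ∈ s, (b n - ext b' n) * φ (x n)‖ ≤ η * M := by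
      rw [hM, Finset.mul_sum]
      refine norm_sum_le_of_le _ fun n hn => ?_
      rw [norm_mul]
      gcongr
      · rw [hext _ _ hn, ← dist_eq_norm]
        exact (dist_le_pi_dist (fun n : s => b n) b' ⟨n, hn⟩).trans hbb'.le
      · refine (hφx _).trans ?_
        have := hx (Sum.inr ⟨n, hn⟩)
        simp only [Sum.elim_inr] at this
        rw [sum_ite_smul hn] at this
        exact this.le
    have h3 : ‖∑ n ∈ s, b n * φ (x n)‖ ≤ c.toReal + δ := by
      have h4 : ∑ n ∈ s, b n * φ (x n) =
          ∑ n ∈ s, ext b' n * φ (x n) + ∑ n ∈ s, (b n - ext b' n) * φ (x n) := by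
        rw [← Finset.sum_add_distrib]
        exact Finset.sum_congr rfl fun n _ => by ring
      have h5 : η + η * M ≤ δ := by
        have : δ = η * (M + 2) := by rw [hη]; field_simp
        rw [this]
        linarith
      rw [h4]
      linarith [norm_add_le (∑ n ∈ s, ext b' n * φ (x n)) (∑ n ∈ s, (b n - ext b' n) * φ (x n))]
    have h6 : (∑ n ∈ s, ‖φ (x n)‖ₑ ^ p) ^ (1 / p) ≤ c + ENNReal.ofReal δ := by
      rw [hb, ← ofReal_norm]
      calc _ ≤ ENNReal.ofReal (c.toReal + δ) := ENNReal.ofReal_le_ofReal h3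
        _ = _ := by rw [ENNReal.ofReal_add ENNReal.toReal_nonneg hδ.le, ENNReal.ofReal_toReal hc]
    rw [one_div, ENNReal.rpow_inv_le_iff h.pos] at h6
    simp only [← ofReal_norm] at h6
    exact h6

end Helly

/-! ### Descent of covers from a larger space to `X`. -/

section Reflexivity

variable {X : Type*} [NormedAddCommGroup X] [NormedSpace ℂ X]
variable {Y : Type*} [NormedAddCommGroup Y] [NormedSpace ℂ Y]
variable {I : Type*}

theorem Covered.of_fintype {κ : Type*} [Fintype κ] {Q : Set (Seminorm ℂ X)} {p : ℝ} (hp : 1 < p)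
    {c : ℝ≥0∞} {y : I → X} {x : κ → X}
    (hx : ∀ q ∈ Q, ∑ k, ENNReal.ofReal (q (x k)) ^ p ≤ c ^ p)
    (h : ∀ i, ∃ a : κ → ℂ, ∑ k, ‖a k‖ₑ ^ p.conjExponent ≤ 1 ∧ y i = ∑ k, a k • x k) :
    Covered Q p y c := by
  refine Covered.of_countable hp (x := x) (fun q hq => ?_)
    (fun ε _ => ⟨Finset.univ, fun q _ => by simp⟩) (fun i => ?_)
  · rw [tsum_fintype]
    exact hx q hq
  · obtain ⟨a, ha, hy⟩ := h i
    refine ⟨a, by rwa [tsum_fintype], ?_⟩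
    rw [hy]
    exact hasSum_fintype _

theorem enorm_sub_rpow_le {p : ℝ} (hp : 1 ≤ p) (a b : ℂ) :
    ‖a - b‖ₑ ^ p ≤ 2 ^ (p - 1) * (‖a‖ₑ ^ p + ‖b‖ₑ ^ p) :=
  calc ‖a - b‖ₑ ^ p ≤ (‖a‖ₑ + ‖b‖ₑ) ^ p := by
        gcongr
        exact enorm_sub_le
    _ ≤ _ := ENNReal.rpow_add_le_mul_rpow_add_rpow _ _ hp

theorem tsum_enorm_sub_rpow_le {p : ℝ} (hp : 1 ≤ p) {a b : ℕ → ℂ}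
    (ha : ∑' n, ‖a n‖ₑ ^ p ≤ 1) (hb : ∑' n, ‖b n‖ₑ ^ p ≤ 1) :
    ∑' n, ‖a n - b n‖ₑ ^ p ≤ 2 ^ p :=
  calc ∑' n, ‖a n - b n‖ₑ ^ p ≤ ∑' n, 2 ^ (p - 1) * (‖a n‖ₑ ^ p + ‖b n‖ₑ ^ p) :=
        ENNReal.tsum_le_tsum fun n => enorm_sub_rpow_le hp _ _
    _ ≤ 2 ^ (p - 1) * (1 + 1) := by
        rw [ENNReal.tsum_mul_left, ENNReal.tsum_add]
        gcongr
    _ = 2 ^ (p - 1) * 2 ^ (1 : ℝ) := by rw [one_add_one_eq_two, ENNReal.rpow_one]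
    _ = 2 ^ p := by
        rw [← ENNReal.rpow_add _ _ two_ne_zero ENNReal.ofNat_ne_top, sub_add_cancel]

/-- Sums whose coefficients are small on a suitable finite set are covered at small cost. -/
theorem Covered.exists_of_small {Q : Set (Seminorm ℂ X)} {p : ℝ} (hp : 1 < p) {ψ : ℕ → X}
    {c : ℝ≥0∞} (hc : c ≠ ∞) (hψ : ULpBound Q p c ψ) (ht : ULpTail Q p ψ) {δ : ℝ≥0∞}
    (hδ0 : δ ≠ 0) (hδ : δ ≠ ∞) (I : Type*) :
    ∃ s : Finset ℕ, ∃ η : ℝ, 0 < η ∧ ∀ w : I → X,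
      (∀ i, ∃ a b : ℕ → ℂ, ∑' n, ‖a n‖ₑ ^ p.conjExponent ≤ 1 ∧
        ∑' n, ‖b n‖ₑ ^ p.conjExponent ≤ 1 ∧ (∀ n ∈ s, ‖a n - b n‖ ≤ η) ∧
        HasSum (fun n => (a n - b n) • ψ n) (w i)) → Covered Q p w δ := by
  classical
  have h := Real.HolderConjugate.conjExponent hp
  set p' := p.conjExponent
  have hD0 : δ ^ p / 2 ≠ 0 :=
    (ENNReal.half_pos (by simp [ENNReal.rpow_eq_zero_iff, hδ0, hδ])).ne'
  have hD : δ ^ p / 2 ≠ ∞ :=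
    ENNReal.div_ne_top (ENNReal.rpow_ne_top_of_nonneg h.nonneg hδ) two_ne_zero
  have h4 : (4 : ℝ≥0∞) ^ p ≠ ∞ := ENNReal.rpow_ne_top_of_nonneg h.nonneg (by simp)
  have hcp : c ^ p + 1 ≠ ∞ :=
    ENNReal.add_ne_top.2 ⟨ENNReal.rpow_ne_top_of_nonneg h.nonneg hc, by simp⟩
  -- The vectors are multiplied by `μ` on `s` and by `4` off `s`. The bound `δ ^ p` splits into
  -- halves: `μ` is small against `c`, and the tail of `ψ` is small against `4 ^ p`.
  obtain ⟨s, hs⟩ := ht (δ ^ p / 2 / 4 ^ p) (ENNReal.div_ne_zero.2 ⟨hD0, h4⟩)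
  obtain ⟨μ, hμ0, hμ⟩ := exists_pos_ofReal_rpow_eq (w := δ ^ p / 2 / (c ^ p + 1))
    (ENNReal.div_ne_zero.2 ⟨hD0, hcp⟩) (ENNReal.div_ne_top hD (by simp)) h.pos
  obtain ⟨θ, hθ0, hθ⟩ := exists_pos_ofReal_rpow_eq (w := 1 / 2 / ((s.card : ℝ≥0∞) + 1))
    (ENNReal.div_ne_zero.2 ⟨by simp, by simp⟩) (ENNReal.div_ne_top (by simp) (by simp))
    h.symm.pos
  refine ⟨s, μ * θ, by positivity, fun w hw => ?_⟩
  let m : ℕ → ℂ := fun n => if n ∈ s then (μ : ℂ) else 4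
  have hm0 : ∀ n, m n ≠ 0 := fun n => by
    by_cases hn : n ∈ s <;> simp [m, hn, hμ0.ne']
  have hμe : ‖(μ : ℂ)‖ₑ = ENNReal.ofReal μ := by
    rw [← ofReal_norm, Complex.norm_real, Real.norm_of_nonneg hμ0.le]
  have h4e : ‖(4 : ℂ)‖ₑ = 4 := by
    rw [← ofReal_norm]
    simp
  have hterm : ∀ (q : Seminorm ℂ X) n, ENNReal.ofReal (q (m n • ψ n)) ^ p ≤
      ENNReal.ofReal μ ^ p * ENNReal.ofReal (q (ψ n)) ^ p +
        4 ^ p * (if n ∈ s then 0 else ENNReal.ofReal (q (ψ n)) ^ p) := fun q n => by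
    rw [ofReal_seminorm_smul, ENNReal.mul_rpow_of_nonneg _ _ h.nonneg]
    by_cases hn : n ∈ s
    · simp [m, hn, hμe]
    · simp only [m, hn, if_false, h4e]
      exact le_add_self
  refine Covered.of_countable hp (x := fun n => m n • ψ n) (fun q hq => ?_) (fun ε hε => ?_)
    (fun i => ?_)
  · calc _ ≤ _ := ENNReal.tsum_le_tsum fun n => hterm q n
      _ ≤ (δ ^ p / 2 / (c ^ p + 1)) * (c ^ p + 1) + 4 ^ p * (δ ^ p / 2 / 4 ^ p) := by
          rw [ENNReal.tsum_add, ENNReal.tsum_mul_left, ENNReal.tsum_mul_left, hμ]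
          gcongr
          · exact (hψ q hq).trans le_self_add
          · refine (le_of_eq (tsum_congr fun n => ?_)).trans (hs q hq)
            split_ifs <;> rfl
      _ ≤ δ ^ p / 2 + δ ^ p / 2 := add_le_add ((mul_comm _ _).trans_le ENNReal.mul_div_le) ENNReal.mul_div_le
      _ = δ ^ p := ENNReal.add_halves _
  · have hA : ENNReal.ofReal μ ^ p + 4 ^ p ≠ ∞ := ENNReal.add_ne_top.2
      ⟨ENNReal.rpow_ne_top_of_nonneg h.nonneg ENNReal.ofReal_ne_top, h4⟩
    obtain ⟨t, ht⟩ := ht (ε / (ENNReal.ofReal μ ^ p + 4 ^ p)) (ENNReal.div_ne_zero.2 ⟨hε, hA⟩)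
    refine ⟨t, fun q hq => ?_⟩
    calc _ ≤ ∑' n, (ENNReal.ofReal μ ^ p + 4 ^ p) *
          (if n ∈ t then 0 else ENNReal.ofReal (q (ψ n)) ^ p) := by
          refine ENNReal.tsum_le_tsum fun n => ?_
          by_cases hn : n ∈ t
          · simp [hn]
          · simp only [hn, if_false]
            refine (hterm q n).trans ?_
            rw [add_mul]
            gcongr
            split_ifs
            · exact zero_le
            · exact le_rfl
      _ ≤ (ENNReal.ofReal μ ^ p + 4 ^ p) * (ε / (ENNReal.ofReal μ ^ p + 4 ^ p)) := by
          rw [ENNReal.tsum_mul_left]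
          gcongr
          refine (le_of_eq (tsum_congr fun n => ?_)).trans (ht q hq)
          split_ifs <;> rfl
      _ ≤ ε := ENNReal.mul_div_le
  · obtain ⟨a, b, ha, hb, hab, hsum⟩ := hw i
    refine ⟨fun n => (m n)⁻¹ * (a n - b n), ?_, ?_⟩
    -- On `s` each quotient is at most `θ`, for a total of at most `1 / 2`. Off `s` the difference
    -- has norm at most `2`, and division by `4` leaves at most `2⁻¹ ^ p' ≤ 1 / 2`.
    · have hcoef : ∀ n, ‖(m n)⁻¹ * (a n - b n)‖ₑ ^ p' ≤
          (if n ∈ s then 1 / 2 / ((s.card : ℝ≥0∞) + 1) else 0) +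
            4⁻¹ ^ p' * ‖a n - b n‖ₑ ^ p' := fun n => by
        rw [enorm_mul, enorm_inv (hm0 n)]
        by_cases hn : n ∈ s
        · simp only [m, hn, if_true, hμe]
          refine le_add_right ?_
          rw [← hθ]
          refine ENNReal.rpow_le_rpow ?_ h.symm.nonneg
          rw [← ENNReal.div_eq_inv_mul]
          refine ENNReal.div_le_of_le_mul ?_
          rw [← ENNReal.ofReal_mul hθ0.le, ← ofReal_norm, mul_comm θ]
          exact ENNReal.ofReal_le_ofReal (hab n hn)
        · simp only [m, hn, if_false, h4e, zero_add]
          rw [ENNReal.mul_rpow_of_nonneg _ _ h.symm.nonneg]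
      have hfin : ∑' n, (if n ∈ s then 1 / 2 / ((s.card : ℝ≥0∞) + 1) else 0) ≤ 1 / 2 := by
        rw [tsum_eq_sum (s := s) (fun n hn => by simp [hn]), Finset.sum_congr rfl
          (fun n hn => if_pos hn), Finset.sum_const, nsmul_eq_mul]
        calc _ ≤ ((s.card : ℝ≥0∞) + 1) * (1 / 2 / ((s.card : ℝ≥0∞) + 1)) := by
              gcongr
              exact le_self_add
          _ ≤ 1 / 2 := ENNReal.mul_div_le
      have h42 : (4⁻¹ : ℝ≥0∞) ^ p' * 2 ^ p' ≤ 1 / 2 := by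
        rw [← ENNReal.mul_rpow_of_nonneg _ _ h.symm.nonneg]
        have : (4⁻¹ : ℝ≥0∞) * 2 = 2⁻¹ := by
          rw [show (4 : ℝ≥0∞) = 2 * 2 by norm_num, ENNReal.mul_inv (by simp) (by simp), mul_assoc,
            ENNReal.inv_mul_cancel (by simp) (by simp), mul_one]
        rw [this, one_div]
        calc (2⁻¹ : ℝ≥0∞) ^ p' ≤ 2⁻¹ ^ (1 : ℝ) :=
              ENNReal.rpow_le_rpow_of_exponent_ge (by simp) h.symm.lt.le
          _ = 2⁻¹ := ENNReal.rpow_one _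
      calc _ ≤ _ := ENNReal.tsum_le_tsum hcoef
        _ ≤ 1 / 2 + 4⁻¹ ^ p' * 2 ^ p' := by
            rw [ENNReal.tsum_add, ENNReal.tsum_mul_left]
            gcongr
            exact tsum_enorm_sub_rpow_le h.symm.lt.le ha hb
        _ ≤ 1 / 2 + 1 / 2 := by gcongr
        _ = 1 := ENNReal.add_halves 1
    · convert hsum using 2 with n
      rw [smul_smul, mul_right_comm, inv_mul_cancel₀ (hm0 n), one_mul]

theorem exists_finite_approx [Nonempty I] (s : Finset ℕ) (a : I → ℕ → ℂ)
    (ha : ∀ i, ∀ n ∈ s, ‖a i n‖ ≤ 1) {η : ℝ} (hη : 0 < η) :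
    ∃ (T : Type) (_ : Fintype T) (code : I → T) (rep : T → I),
      ∀ i, ∀ n ∈ s, ‖a i n - a (rep (code i)) n‖ ≤ η := by
  obtain ⟨t, -, htf, htc⟩ := Metric.finite_approx_of_totallyBounded
    (isCompact_closedBall (0 : s → ℂ) 1).totallyBounded (η / 2) (half_pos hη)
  have hmem : ∀ i, ∃ b : t, dist (fun n : s => a i n) b < η / 2 := fun i => by
    have : (fun n : s => a i n) ∈ Metric.closedBall (0 : s → ℂ) 1 := by
      rw [mem_closedBall_zero_iff, pi_norm_le_iff_of_nonneg zero_le_one]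
      exact fun n => ha i n n.2
    obtain ⟨b, hb, h⟩ := Set.mem_iUnion₂.1 (htc this)
    exact ⟨⟨b, hb⟩, h⟩
  choose code hcode using hmem
  -- Representatives are indices in `I`, not net points. An index and its representative share a net
  -- point, hence the radius `η / 2`.
  refine ⟨t, htf.fintype, code, Function.invFun code, fun i n hn => ?_⟩
  have h1 : code (Function.invFun code (code i)) = code i := Function.invFun_eq ⟨i, rfl⟩
  have h2 := hcode (Function.invFun code (code i))
  rw [h1] at h2
  rw [← dist_eq_norm]
  calc dist (a i n) (a (Function.invFun code (code i)) n)
      ≤ dist (fun n : s => a i n) (fun n : s => a (Function.invFun code (code i)) n) :=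
        dist_le_pi_dist (fun n : s => a i n) (fun n : s => a (Function.invFun code (code i)) n)
          ⟨n, hn⟩
    _ ≤ _ := dist_triangle_right _ _ (code i : s → ℂ)
    _ ≤ η := by linarith [hcode i]

/-- Finitely many strict norm inequalities satisfied in `Y` can be satisfied in `X`. -/
def IsHellyMap (j : X →L[ℂ] Y) : Prop :=
  ∀ (J : Type) [Fintype J] (s : Finset ℕ) (c : J → ℕ → ℂ) (ψ : ℕ → Y) (y : J → X) (r : J → ℝ),
    (∀ k, ‖∑ n ∈ s, c k n • ψ n - j (y k)‖ < r k) →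
    ∃ x : ℕ → X, ∀ k, ‖∑ n ∈ s, c k n • x n - y k‖ < r k

/-- Here `y₁` takes finitely many values, which Helly's lemma handles inside `X`. The remainder `y₂`
is a difference of two values of `y` with nearly equal coefficients on `s`, so it is cheap in `Y`.
-/
theorem Covered.exists_split [CompleteSpace X] {Q : Set (Seminorm ℂ X)} {Q' : Set (Seminorm ℂ Y)}
    (hQ : IsNorming Q) {p : ℝ} (hp : 1 < p) (hT : FinitelyTestable Q Q' p) {j : X →L[ℂ] Y}
    (hj : IsHellyMap j) {y : I → X} {c : ℝ≥0∞} (hc0 : c ≠ 0) (hc : c ≠ ∞)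
    (hy : Covered Q' p (fun i => j (y i)) c) {δ : ℝ} (hδ : 0 < δ) :
    ∃ y₁ y₂ : I → X, y = y₁ + y₂ ∧ Covered Q p y₁ (c + ENNReal.ofReal δ) ∧
      Covered Q' p (fun i => j (y₂ i)) (ENNReal.ofReal δ) := by
  classical
  rcases isEmpty_or_nonempty I with hI | hI
  · refine ⟨0, 0, Subsingleton.elim _ _, Covered.zero hp _, ?_⟩
    rw [Subsingleton.elim (fun i => j ((0 : I → X) i)) 0]
    exact Covered.zero hp _
  have h := Real.HolderConjugate.conjExponent hp
  obtain ⟨ψ, hψ, hψt, hyψ⟩ := hy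
  choose a ha hay using hyψ
  have ha1 : ∀ i, ∑' n, ‖a i n‖ₑ ^ p.conjExponent ≤ 1 := fun i => by
    have := ha i
    rwa [seqENorm_le_iff h.symm.pos, ENNReal.one_rpow] at this
  have ha2 : ∀ i n, ‖a i n‖ ≤ 1 := fun i n => by
    have h1 : ‖a i n‖ₑ ^ p.conjExponent ≤ 1 := (ENNReal.le_tsum n).trans (ha1 i)
    have h2 : ‖a i n‖ₑ ≤ 1 := (ENNReal.rpow_le_rpow_iff h.symm.pos).1
      (h1.trans_eq (ENNReal.one_rpow p.conjExponent).symm)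
    rwa [← ofReal_norm, ENNReal.ofReal_le_one] at h2
  have hδe : ENNReal.ofReal δ ≠ 0 := by simpa using hδ
  have hδ2 : ENNReal.ofReal (δ / 2) ≠ 0 := by simpa using hδ
  obtain ⟨s, η, hη, hsmall⟩ := Covered.exists_of_small hp hc hψ hψt hδe ENNReal.ofReal_ne_top I
  obtain ⟨T, hTf, code, rep, hrep⟩ := exists_finite_approx s a (fun i n _ => ha2 i n) hη
  refine ⟨fun i => y (rep (code i)), fun i => y i - y (rep (code i)), by ext i; simp, ?_, ?_⟩
  · obtain ⟨ρ, hρ0, hρ⟩ := exists_pos_ofReal_rpow_eq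
      (w := ENNReal.ofReal (δ / 2) ^ p / ((Fintype.card T : ℝ≥0∞) + 1))
      (ENNReal.div_ne_zero.2 ⟨by simp [ENNReal.rpow_eq_zero_iff, hδ], by simp⟩)
      (ENNReal.div_ne_top (ENNReal.rpow_ne_top_of_nonneg h.nonneg ENNReal.ofReal_ne_top) (by simp))
      h.pos
    have hev : ∀ᶠ t : Finset ℕ in atTop, ∀ k : T,
        ‖∑ n ∈ t, a (rep k) n • ψ n - j (y (rep k))‖ < ρ := by
      rw [eventually_all]
      intro k
      have := Metric.tendsto_nhds.1 (hay (rep k)) ρ hρ0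
      filter_upwards [this] with t ht
      rwa [dist_eq_norm] at ht
    obtain ⟨t, ht⟩ := hev.exists
    obtain ⟨J, hJ, b, r, hbr, htest⟩ := hT t ψ c hc
      (fun q hq => (ENNReal.sum_le_tsum t).trans (hψ q hq)) (δ / 2) (half_pos hδ)
    -- One system of inequalities keeps the sums near the representatives (`T`) and the cost near
    -- `c` (`J`).
    obtain ⟨x, hx⟩ := hj (T ⊕ J) t (Sum.elim (fun k => a (rep k)) b) ψ
      (Sum.elim (fun k => y (rep k)) 0) (Sum.elim (fun _ => ρ) r) (by
        rintro (k | k)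
        · exact ht k
        · simpa using hbr k)
    have hxT : ∀ k, ‖y (rep k) - ∑ n ∈ t, a (rep k) n • x n‖ ≤ ρ := fun k => by
      rw [norm_sub_rev]
      exact (hx (Sum.inl k)).le
    have hxQ := htest x fun k => by simpa using hx (Sum.inr k)
    have h1 : Covered Q p (fun i => ∑ n ∈ t, a (rep (code i)) n • x n)
        (c + ENNReal.ofReal (δ / 2)) := by
      refine Covered.of_fintype hp (x := fun n : t => x n) (fun q hq => ?_)
        (fun i => ⟨fun n => a (rep (code i)) n, ?_, ?_⟩)
      · rw [Finset.sum_coe_sort t (fun n => ENNReal.ofReal (q (x n)) ^ p)]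
        exact hxQ q hq
      · rw [Finset.sum_coe_sort t (fun n => ‖a (rep (code i)) n‖ₑ ^ p.conjExponent)]
        exact (ENNReal.sum_le_tsum t).trans (ha1 _)
      · rw [Finset.sum_coe_sort t (fun n => a (rep (code i)) n • x n)]
    -- The finitely many approximation errors serve as their own covering vectors, with unit
    -- coefficient vectors.
    have h2 : Covered Q p (fun i => y (rep (code i)) - ∑ n ∈ t, a (rep (code i)) n • x n)
        (ENNReal.ofReal (δ / 2)) := by
      refine Covered.of_fintype hp (x := fun k => y (rep k) - ∑ n ∈ t, a (rep k) n • x n)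
        (fun q hq => ?_) (fun i => ⟨Pi.single (code i) 1, ?_, ?_⟩)
      · calc _ ≤ ∑ k : T, ENNReal.ofReal ρ ^ p := by
              gcongr with k
              exact (hQ.le_norm q hq _).trans (hxT k)
          _ ≤ ((Fintype.card T : ℝ≥0∞) + 1) * ENNReal.ofReal ρ ^ p := by
              rw [Finset.sum_const, nsmul_eq_mul, Finset.card_univ]
              gcongr
              exact le_self_add
          _ ≤ _ := by
              rw [hρ]
              exact ENNReal.mul_div_le
      · rw [Finset.sum_eq_single (code i) (fun k _ hk => by simp [hk, h.symm.pos]) (by simp)]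
        simp
      · rw [Finset.sum_eq_single (code i) (fun k _ hk => by simp [hk]) (by simp)]
        simp
    have h3 := h1.add hQ hp h2 (by simp [hc0]) (by simp [hc]) hδ2 ENNReal.ofReal_ne_top
    rw [add_assoc, ← ENNReal.ofReal_add (by positivity) (by positivity), add_halves] at h3
    convert h3 using 1
    ext i
    simp
  · refine hsmall _ fun i => ⟨a i, a (rep (code i)), ha1 _, ha1 _, hrep i, ?_⟩
    simpa only [sub_smul, map_sub] using (hay i).sub (hay (rep (code i)))

/-- Split off pieces indefinitely: stage `n` starts from a cover in `Y` of cost `e n` and yields a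
piece in `X` of cost `e n + δ n`. -/
theorem Covered.of_hellyMap [CompleteSpace X] {Q : Set (Seminorm ℂ X)} {Q' : Set (Seminorm ℂ Y)}
    (hQ : IsNorming Q) (hQ' : IsNorming Q') {p : ℝ} (hp : 1 < p) (hT : FinitelyTestable Q Q' p)
    {j : X →L[ℂ] Y} (hj : IsHellyMap j) (hji : ∀ x, ‖j x‖ = ‖x‖) {y : I → X} {c d : ℝ≥0∞}
    (hcd : c < d) (hy : Covered Q' p (fun i => j (y i)) c) : Covered Q p y d := by
  -- The cost `c` may be zero, but splitting needs a positive cost.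
  obtain ⟨c₀, hc₀, hc₀d⟩ := exists_between hcd
  have hc₀0 : c₀ ≠ 0 := (pos_of_gt hc₀).ne'
  have hc₀t : c₀ ≠ ∞ := hc₀d.ne_top
  -- Each `δ n` is paid twice, in the piece of stage `n` and as the next remainder, hence the half
  -- of `d - c₀`.
  obtain ⟨δ, hδ0, hδ⟩ := ENNReal.exists_pos_sum_of_countable
    (ENNReal.half_pos (tsub_pos_of_lt hc₀d).ne').ne' ℕ
  let e : ℕ → ℝ≥0∞ := fun n => Nat.casesOn n c₀ fun k => δ k
  have he0 : ∀ n, e n ≠ 0 := by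
    rintro (_ | k)
    · exact hc₀0
    · exact ENNReal.coe_ne_zero.2 (hδ0 k).ne'
  have het : ∀ n, e n ≠ ∞ := by
    rintro (_ | k)
    · exact hc₀t
    · exact ENNReal.coe_ne_top
  have hstep : ∀ n (z : {z : I → X // Covered Q' p (fun i => j (z i)) (e n)}),
      ∃ (u : I → X) (z' : {z : I → X // Covered Q' p (fun i => j (z i)) (e (n + 1))}),
        z.1 = u + z'.1 ∧ Covered Q p u (e n + δ n) := fun n z => by
    obtain ⟨u, z', h1, h2, h3⟩ := z.2.exists_split hQ hp hT hj (he0 n) (het n)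
      (NNReal.coe_pos.2 (hδ0 n))
    rw [ENNReal.ofReal_coe_nnreal] at h2 h3
    exact ⟨u, ⟨z', h3⟩, h1, h2⟩
  choose u z' huz hu using hstep
  let Z : ∀ n, {z : I → X // Covered Q' p (fun i => j (z i)) (e n)} := fun n =>
    Nat.rec ⟨y, hy.mono (zero_le_one.trans hp.le) hc₀.le⟩ (fun k z => z' k z) n
  have hZ0 : (Z 0).1 = y := rfl
  have hZ : ∀ n, (Z n).1 = u n (Z n) + (Z (n + 1)).1 := fun n => huz n (Z n)
  have hδe : ∑' n, e (n + 1) ≠ ∞ := hδ.ne_top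
  have hesum : ∑' n, e n = c₀ + ∑' n, (δ n : ℝ≥0∞) := tsum_eq_zero_add' ENNReal.summable
  have htot : ∑' n, (e n + δ n) ≤ d := by
    rw [ENNReal.tsum_add, hesum, add_assoc]
    calc _ ≤ c₀ + ((d - c₀) / 2 + (d - c₀) / 2) := by gcongr
      _ = d := by rw [ENNReal.add_halves, add_tsub_cancel_of_le hc₀d.le]
  have htot' : ∑' n, (e n + δ n) ≠ ∞ := by
    rw [ENNReal.tsum_add, hesum]
    exact ENNReal.add_ne_top.2 ⟨ENNReal.add_ne_top.2 ⟨hc₀t, hδe⟩, hδe⟩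
  refine (Covered.hasSum hQ hp (c := fun n => e n + δ n) (y := fun n => u n (Z n)) (z := y)
    (fun n => by simp [he0 n]) htot' (fun n => hu n (Z n)) fun i => ?_).mono
    (zero_le_one.trans hp.le) htot
  have hubound : ∀ n, ‖u n (Z n) i‖ₑ ≤ e n + δ n := fun n => by
    obtain ⟨x, hx, -, hxy⟩ := hu n (Z n)
    exact enorm_le_of_mem_pConv hQ hp hx (hxy i)
  have hZbound : ∀ n, ‖(Z n).1 i‖ₑ ≤ e n := fun n => by
    obtain ⟨x, hx, -, hxy⟩ := (Z n).2
    have := enorm_le_of_mem_pConv hQ' hp hx (hxy i)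
    rwa [← ofReal_norm, hji, ofReal_norm] at this
  have hsummable : Summable fun n => u n (Z n) i := by
    refine Summable.of_enorm ((ENNReal.tsum_le_tsum hubound).trans_lt htot'.lt_top).ne
  rw [hsummable.hasSum_iff_tendsto_nat]
  have hpartial : ∀ n, ∑ k ∈ Finset.range n, u k (Z k) i = y i - (Z n).1 i := fun n => by
    induction n with
    | zero => simp [hZ0]
    | succ n ih =>
      rw [Finset.sum_range_succ, ih, hZ n, Pi.add_apply]
      abel
  simp only [hpartial]
  -- The remainders are bounded only in `Y`; the isometry `j` brings the bound back to `X`.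
  have hlim : Tendsto (fun n => (Z n).1 i) atTop (𝓝 0) := by
    rw [tendsto_zero_iff_enorm_tendsto_zero]
    have h1 : Tendsto e atTop (𝓝 0) := ENNReal.tendsto_atTop_zero_of_tsum_ne_top
      (by rw [hesum]; exact ENNReal.add_ne_top.2 ⟨hc₀t, hδe⟩)
    exact tendsto_of_tendsto_of_tendsto_of_le_of_le tendsto_const_nhds h1 (fun _ => zero_le) hZbound
  simpa using tendsto_const_nhds.sub hlim

end Reflexivity

/-! ### From domination by a sequence to a series expansion. -/

section DualityLp

variable {G : Type*} [NormedAddCommGroup G] [NormedSpace ℂ G]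

/-- Domination makes `Φ` factor through `T : g ↦ (ψ n g)` by a functional of norm at most one on the
range. A Hahn–Banach extension `Λ` to `ℓ_p` has coefficients `a n` on the unit vectors. -/
theorem exists_coeff_of_le_seqENorm {p : ℝ} (hp : 1 < p) {ψ : ℕ → StrongDual ℂ G}
    {Φ : StrongDual ℂ G} (hfin : ∀ g, seqENorm p (fun n => ψ n g) ≠ ∞)
    (hΦ : ∀ g, ‖Φ g‖ₑ ≤ seqENorm p (fun n => ψ n g)) :
    ∃ a : ℕ → ℂ, ∑' n, ‖a n‖ₑ ^ p.conjExponent ≤ 1 ∧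
      ∀ g, HasSum (fun n => a n * ψ n g) (Φ g) := by
  have h := Real.HolderConjugate.conjExponent hp
  set P : ℝ≥0∞ := ENNReal.ofReal p with hP
  have hPp : P.toReal = p := ENNReal.toReal_ofReal h.nonneg
  have hPp0 : 0 < P.toReal := by rw [hPp]; exact h.pos
  have : Fact (1 ≤ P) := ⟨by rw [hP]; simpa using hp.le⟩
  have hmem : ∀ u : ℕ → ℂ, ∑' n, ‖u n‖ₑ ^ p ≠ ∞ → Memℓp u P := fun u hu => by
    refine memℓp_gen ?_
    rw [hPp]
    have := ENNReal.summable_toReal hu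
    simpa [← ENNReal.toReal_rpow] using this
  have hnorm : ∀ u : lp (fun _ : ℕ => ℂ) P, ‖u‖ₑ = (∑' n, ‖u n‖ₑ ^ p) ^ (1 / p) := fun u => by
    have h1 := lp.hasSum_norm hPp0 u
    rw [hPp] at h1
    have h2 : ∑' n, ‖u n‖ₑ ^ p = ENNReal.ofReal (‖u‖ ^ p) := by
      rw [← h1.tsum_eq, ENNReal.ofReal_tsum_of_nonneg (fun n => by positivity) h1.summable]
      refine tsum_congr fun n => ?_
      rw [← ofReal_norm, ENNReal.ofReal_rpow_of_nonneg (norm_nonneg _) h.nonneg]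
    rw [h2, ← ENNReal.ofReal_rpow_of_nonneg (norm_nonneg _) h.nonneg, one_div,
      ENNReal.rpow_rpow_inv h.ne_zero, ofReal_norm]
  have hfin' : ∀ g, ∑' n, ‖ψ n g‖ₑ ^ p ≠ ∞ := fun g hg => by
    apply hfin g
    rw [seqENorm, hg, ENNReal.top_rpow_of_pos (one_div_pos.2 h.pos)]
  let T : G →ₗ[ℂ] lp (fun _ : ℕ => ℂ) P :=
    { toFun := fun g => ⟨fun n => ψ n g, hmem _ (hfin' g)⟩
      map_add' := fun g g' => Subtype.ext (funext fun n => map_add (ψ n) g g')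
      map_smul' := fun c g => Subtype.ext (funext fun n => map_smul (ψ n) c g) }
  have hTn : ∀ g, ‖Φ g‖ ≤ ‖T g‖ := fun g => by
    have h1 := hΦ g
    have h2 : seqENorm p (fun n => ψ n g) = ‖T g‖ₑ := (hnorm (T g)).symm
    rw [h2, ← ofReal_norm, ← ofReal_norm, ENNReal.ofReal_le_ofReal_iff (norm_nonneg _)] at h1
    exact h1
  obtain ⟨f, hf⟩ : ∃ f : Module.Dual ℂ (LinearMap.range T), ∀ g, f (T.rangeRestrict g) = Φ g := by
    have h1 : (Φ : G →ₗ[ℂ] ℂ) ∈ LinearMap.range T.rangeRestrict.dualMap := by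
      rw [LinearMap.range_dualMap_eq_dualAnnihilator_ker, Submodule.mem_dualAnnihilator]
      intro g hg
      have h2 : T g = 0 := by simpa using hg
      have := hTn g
      rw [h2, norm_zero] at this
      exact norm_le_zero_iff.1 this
    obtain ⟨f, hf⟩ := h1
    exact ⟨f, fun g => by simpa using LinearMap.congr_fun hf g⟩
  let f' : StrongDual ℂ (LinearMap.range T) := f.mkContinuous 1 (by
    rintro ⟨_, g, rfl⟩
    rw [one_mul]
    exact (congrArg norm (hf g)).trans_le (hTn g))
  obtain ⟨Λ, hΛ, hΛn⟩ := exists_extension_norm_eq (LinearMap.range T) f'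
  have hΛ1 : ‖Λ‖ ≤ 1 := hΛn.trans_le (LinearMap.mkContinuous_norm_le _ zero_le_one _)
  have hΛT : ∀ g, Λ (T g) = Φ g := fun g => (hΛ (T.rangeRestrict g)).trans (hf g)
  let a : ℕ → ℂ := fun n => Λ (lp.single P n 1)
  have hsingle : ∀ n (z : ℂ), Λ (lp.single P n z) = a n * z := fun n z => by
    have : (lp.single P n z : lp (fun _ : ℕ => ℂ) P) = z • lp.single P n 1 := by
      rw [← lp.single_smul, smul_eq_mul, mul_one]
    rw [this, map_smul, smul_eq_mul, mul_comm]
  refine ⟨a, ?_, fun g => ?_⟩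
  · rw [ENNReal.tsum_eq_iSup_sum]
    refine iSup_le fun s => ?_
    -- Testing `Λ` on the extremal vector `b` bounds the finite section of `a` by `‖Λ‖`.
    obtain ⟨b, hb1, hb⟩ := exists_sum_mul_eq_Lp h.symm s a
    have hsum : ∑ n ∈ s, b n * a n = Λ (∑ n ∈ s, lp.single P n (b n)) := by
      rw [map_sum]
      exact Finset.sum_congr rfl fun n _ => by rw [hsingle, mul_comm]
    have hle : ‖∑ n ∈ s, lp.single P n (b n)‖ₑ ≤ 1 := by
      have h1 := lp.norm_sum_single hPp0 b s
      rw [hPp] at h1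
      have h2 : ∑ n ∈ s, ‖b n‖ ^ p ≤ 1 := by
        rw [← ENNReal.ofReal_le_one, ENNReal.ofReal_sum_of_nonneg fun n _ => by positivity]
        simpa only [← ofReal_norm, ENNReal.ofReal_rpow_of_nonneg (norm_nonneg _) h.nonneg] using hb1
      rw [← ofReal_norm, ENNReal.ofReal_le_one]
      by_contra! hgt
      have := Real.one_lt_rpow hgt h.pos
      linarith
    have hfinal : (∑ n ∈ s, ‖a n‖ₑ ^ p.conjExponent) ^ (1 / p.conjExponent) ≤ 1 := by
      rw [hb, hsum]
      calc _ ≤ ‖Λ‖ₑ * ‖∑ n ∈ s, lp.single P n (b n)‖ₑ := Λ.le_opENorm _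
        _ ≤ 1 * 1 := by
            gcongr
            rw [← ofReal_norm, ENNReal.ofReal_le_one]
            exact hΛ1
        _ = 1 := one_mul 1
    rwa [one_div, ENNReal.rpow_inv_le_iff h.symm.pos, ENNReal.one_rpow] at hfinal
  · have h1 := (lp.hasSum_single (ENNReal.ofReal_ne_top : P ≠ ∞) (T g)).mapL Λ
    rw [hΛT] at h1
    have h2 : (fun n => Λ (lp.single P n (T g n))) = fun n => a n * ψ n g :=
      funext fun n => hsingle n (ψ n g)
    rwa [h2] at h1

/-- Duality gives only pointwise convergence; the uniform tails upgrade it to norm convergence with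
the same sum. -/
theorem mem_pConv_of_le_seqENorm {p : ℝ} (hp : 1 < p) {Q : Set (Seminorm ℂ (StrongDual ℂ G))}
    (hQ : IsNorming Q) {ψ : ℕ → StrongDual ℂ G} (ht : ULpTail Q p ψ)
    {Φ : StrongDual ℂ G} (hfin : ∀ g, seqENorm p (fun n => ψ n g) ≠ ∞)
    (hΦ : ∀ g, ‖Φ g‖ₑ ≤ seqENorm p (fun n => ψ n g)) : Φ ∈ pConv p ψ := by
  have h := Real.HolderConjugate.conjExponent hp
  obtain ⟨a, ha, hsum⟩ := exists_coeff_of_le_seqENorm hp hfin hΦ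
  refine ⟨a, by rwa [seqENorm_le_iff h.symm.pos, ENNReal.one_rpow], ?_⟩
  have hS := (ht.summable_smul hQ h ha).hasSum
  convert hS
  ext g
  exact (hsum g).unique (hS.mapL (ContinuousLinearMap.apply ℂ ℂ g))

end DualityLp

/-! ### Translation between the two sequence spaces and the seminorm families. -/

section Bridges

variable {X : Type*} [NormedAddCommGroup X] [NormedSpace ℂ X]

theorem tsum_strongFamily {p : ℝ} (x : ℕ → X) :
    ∑' n, ENNReal.ofReal (normSeminorm ℂ X (x n)) ^ p = ∑' n, ‖x n‖ₑ ^ p :=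
  tsum_congr fun n => by rw [coe_normSeminorm, ofReal_norm]

theorem ulpBound_strongFamily_iff {p : ℝ} (hp : 0 < p) {x : ℕ → X} {c : ℝ≥0∞} :
    ULpBound (strongFamily X) p c x ↔ seqENorm p x ≤ c := by
  rw [seqENorm_le_iff hp, ← tsum_strongFamily]
  exact ⟨fun h => h _ rfl, by rintro h q rfl; exact h⟩

theorem ulpBound_weakFamily_iff {p : ℝ} (hp : 0 < p) {x : ℕ → X} {c : ℝ≥0∞} :
    ULpBound (weakFamily X) p c x ↔ weakSeqENorm p x ≤ c := by
  simp only [weakSeqENorm, iSup_le_iff, seqENorm_le_iff hp, ← ofReal_norm]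
  constructor
  · intro h φ hφ
    exact h _ ⟨φ, hφ, rfl⟩
  · rintro h _ ⟨φ, hφ, rfl⟩
    exact h φ hφ

theorem ulpTail_strongFamily {p : ℝ} (hp : 0 < p) {x : ℕ → X} (hx : x ∈ pSummable p X) :
    ULpTail (strongFamily X) p x := by
  intro ε hε
  have h1 : ∑' n, ENNReal.ofReal (normSeminorm ℂ X (x n)) ^ p ≠ ∞ := by
    rw [tsum_strongFamily]
    intro h
    have hx' : seqENorm p x < ∞ := hx
    rw [seqENorm, h, ENNReal.top_rpow_of_pos (one_div_pos.2 hp)] at hx'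
    exact lt_irrefl _ hx'
  obtain ⟨s, hs⟩ := ((tendsto_order.1 (ENNReal.tendsto_tsum_compl_atTop_zero h1)).2 ε
    (pos_iff_ne_zero.2 hε)).exists
  refine ⟨s, ?_⟩
  rintro q rfl
  rw [tsum_ite_mem_zero]
  exact hs.le

open Classical in
theorem tsum_add_eq_tsum_ite (f : ℕ → ℝ≥0∞) (m : ℕ) :
    ∑' n, f (n + m) = ∑' n, (if n ∈ Finset.range m then 0 else f n) := by
  rw [← ENNReal.summable.sum_add_tsum_nat_add' (f := fun n => if n ∈ Finset.range m then 0 else f n)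
    (k := m), Finset.sum_eq_zero fun n hn => if_pos hn, zero_add]
  exact tsum_congr fun n => by simp

/-- Every finite set of indices lies in an initial segment, so discarding finite sets amounts to
shifting. -/
theorem ulpTail_weakFamily_iff {p : ℝ} (hp : 0 < p) {x : ℕ → X} :
    ULpTail (weakFamily X) p x ↔
      Tendsto (fun m : ℕ => weakSeqENorm p (fun n => x (n + m))) atTop (𝓝 0) := by
  classical
  rw [ENNReal.tendsto_atTop_zero]
  constructor
  · intro h ε hε
    rcases eq_or_ne ε ∞ with rfl | hεt
    · exact ⟨0, fun n _ => le_top⟩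
    obtain ⟨s, hs⟩ := h (ε ^ p) (by simp [ENNReal.rpow_eq_zero_iff, hε.ne', hεt])
    obtain ⟨M, hM⟩ := s.exists_nat_subset_range
    refine ⟨M, fun m hm => ?_⟩
    rw [← ulpBound_weakFamily_iff hp]
    intro q hq
    rw [tsum_add_eq_tsum_ite (fun n => ENNReal.ofReal (q (x n)) ^ p)]
    refine le_trans (ENNReal.tsum_le_tsum fun n => ?_) (hs q hq)
    by_cases hn : n ∈ s
    · have := Finset.range_mono hm (hM hn)
      simp [this]
    · rw [if_neg hn]
      split_ifs
      · exact zero_le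
      · exact le_rfl
  · intro h ε hε
    rcases eq_or_ne ε ∞ with rfl | hεt
    · exact ⟨∅, fun q hq => le_top⟩
    obtain ⟨m, hm⟩ := h (ε ^ (1 / p)) (pos_iff_ne_zero.2
      (by simp [ENNReal.rpow_eq_zero_iff, hε, hεt]))
    refine ⟨Finset.range m, fun q hq => ?_⟩
    have h1 := (ulpBound_weakFamily_iff hp).2 (hm m le_rfl) q hq
    rw [tsum_add_eq_tsum_ite (fun n => ENNReal.ofReal (q (x n)) ^ p), one_div,
      ENNReal.rpow_inv_rpow hp.ne'] at h1
    convert h1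

theorem seqENorm_mono {X Y : Type*} [NormedAddCommGroup X] [NormedAddCommGroup Y] {p : ℝ} (hp : 0 ≤ p) {x : ℕ → X}
    {y : ℕ → Y} (h : ∀ n, ‖x n‖ ≤ ‖y n‖) : seqENorm p x ≤ seqENorm p y := by
  unfold seqENorm
  gcongr with n
  exact enorm_le_iff_norm_le.2 (h n)

theorem mem_closedBall_dual {φ : StrongDual ℂ X} :
    φ ∈ Metric.closedBall (0 : StrongDual ℂ X) 1 ↔ ‖φ‖ ≤ 1 :=
  mem_closedBall_zero_iff

end Bridges

/-! ### The canonical embedding into the bidual. -/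

section Bidual

variable {F : Type*} [NormedAddCommGroup F] [NormedSpace ℂ F]

theorem isHellyMap_inclusionInDoubleDual :
    IsHellyMap (X := F) (Y := StrongDual ℂ (StrongDual ℂ F)) (NormedSpace.inclusionInDoubleDual ℂ F) :=
  fun _ _ s c ψ y r h => exists_norm_sum_smul_sub_lt s c ψ y r h

theorem norm_inclusionInDoubleDual (x : F) : ‖NormedSpace.inclusionInDoubleDual ℂ F x‖ = ‖x‖ :=
  (NormedSpace.inclusionInDoubleDualLi ℂ).norm_map x

theorem seqENorm_inclusionInDoubleDual (p : ℝ) (x : ℕ → F) :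
    seqENorm p (fun n => NormedSpace.inclusionInDoubleDual ℂ F (x n)) = seqENorm p x := by
  unfold seqENorm
  simp only [← ofReal_norm, norm_inclusionInDoubleDual]

/-- A functional in the unit ball of the triple dual restricts to one in the unit ball of the dual
of `F`. -/
theorem weakSeqENorm_inclusionInDoubleDual_le (p : ℝ) (x : ℕ → F) :
    weakSeqENorm p (fun n => NormedSpace.inclusionInDoubleDual ℂ F (x n)) ≤ weakSeqENorm p x := by
  refine iSup₂_le fun ξ hξ => ?_
  let φ : StrongDual ℂ F := ξ.comp (NormedSpace.inclusionInDoubleDual ℂ F)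
  have hφ : φ ∈ Metric.closedBall (0 : StrongDual ℂ F) 1 := by
    rw [mem_closedBall_zero_iff] at hξ ⊢
    refine ContinuousLinearMap.opNorm_le_bound _ zero_le_one fun z => ?_
    exact (ξ.le_of_opNorm_le hξ _).trans_eq (congrArg (1 * ·) (norm_inclusionInDoubleDual z))
  exact le_iSup₂ (f := fun φ (_ : φ ∈ Metric.closedBall (0 : StrongDual ℂ F) 1) =>
    seqENorm p (fun n => φ (x n))) φ hφ

theorem seqENorm_const_mul {p : ℝ} (hp : 0 < p) (c : ℂ) (u : ℕ → ℂ) :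
    seqENorm p (fun n => c * u n) = ‖c‖ₑ * seqENorm p u := by
  unfold seqENorm
  simp only [enorm_mul, ENNReal.mul_rpow_of_nonneg _ _ hp.le]
  rw [ENNReal.tsum_mul_left, ENNReal.mul_rpow_of_nonneg _ _ (one_div_nonneg.2 hp.le), one_div,
    ENNReal.rpow_rpow_inv hp.ne']

/-- A multiple of `g` of norm less than one acts as a member of the bidual unit ball, over which the
weak norm is taken. -/
theorem seqENorm_apply_ne_top {G : Type*} [NormedAddCommGroup G] [NormedSpace ℂ G]
    {p : ℝ} (hp : 0 < p) {ψ : ℕ → StrongDual ℂ G} (hψ : weakSeqENorm p ψ ≠ ∞) (g : G) : seqENorm p (fun n => ψ n g) ≠ ∞ := by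
  intro htop
  let t : ℂ := ((‖g‖ + 1 : ℝ) : ℂ)⁻¹
  have ht : ‖t‖ = (‖g‖ + 1)⁻¹ := by
    rw [norm_inv, Complex.norm_real, Real.norm_of_nonneg (by positivity)]
  have ht0 : ‖t‖ₑ ≠ 0 := by
    rw [enorm_ne_zero, ← norm_pos_iff, ht]
    positivity
  have hmem : NormedSpace.inclusionInDoubleDual ℂ G (t • g) ∈
      Metric.closedBall (0 : StrongDual ℂ (StrongDual ℂ G)) 1 := by
    refine (mem_closedBall_dual (X := StrongDual ℂ G)).2
      ((norm_inclusionInDoubleDual (t • g)).trans_le ?_)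
    rw [norm_smul, ht, inv_mul_le_iff₀ (by positivity)]
    linarith
  have h1 : seqENorm p (fun n => t * ψ n g) ≤ weakSeqENorm p ψ := by
    have := le_iSup₂ (f := fun ξ (_ : ξ ∈ Metric.closedBall
      (0 : StrongDual ℂ (StrongDual ℂ G)) 1) => seqENorm p (fun n => ξ (ψ n))) _ hmem
    refine le_trans (le_of_eq (congrArg (seqENorm p) (funext fun n => ?_))) this
    exact (map_smul (ψ n) t g).symm
  rw [seqENorm_const_mul hp, htop, ENNReal.mul_top ht0] at h1
  exact hψ (top_le_iff.1 h1)

theorem weakSeqENorm_le_seqENorm {p : ℝ} (hp : 0 ≤ p) (x : ℕ → F) :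
    weakSeqENorm p x ≤ seqENorm p x :=
  iSup₂_le fun φ hφ => seqENorm_mono hp fun n =>
    (φ.le_of_opNorm_le (by simpa using hφ) _).trans_eq (one_mul _)

theorem enorm_apply_le_of_mem_pConv {p : ℝ} (hp : 1 < p) {x : ℕ → F} {y : F} (hy : y ∈ pConv p x)
    (φ : StrongDual ℂ F) : ‖φ y‖ₑ ≤ seqENorm p (fun n => φ (x n)) := by
  obtain ⟨a, ha, hs⟩ := hy
  have h : ULpBound (strongFamily ℂ) p (seqENorm p fun n => φ (x n)) (fun n => φ (x n)) :=
    (ulpBound_strongFamily_iff (by linarith)).2 le_rfl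
  refine enorm_le_of_mem_pConv isNorming_strongFamily hp h ⟨a, ha, ?_⟩
  simpa using hs.mapL φ

end Bidual

/-! ### The transpose and the `v`-range. -/

section Transpose

variable {E : Type*} [NormedAddCommGroup E] [NormedSpace ℂ E] {U : TopologicalSpace.Opens E}
  {v : Weight U} {F : Type*} [NormedAddCommGroup F] [NormedSpace ℂ F]

theorem WeightedHol.enorm_transpose_le_iff (f : WeightedHol v F) (φ : StrongDual ℂ F) (c : ℝ≥0∞) :
    ‖f.transpose φ‖ₑ ≤ c ↔ ∀ y ∈ f.vRange, ‖φ y‖ₑ ≤ c := by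
  have hval : ∀ x : U, ‖φ ((v.toFun x : ℂ) • f x)‖ = v.toFun x * ‖f.transpose φ x‖ := fun x => by
    rw [map_smul, norm_smul, Complex.norm_real, Real.norm_of_nonneg (v.pos x).le]
    rfl
  constructor
  · rintro h _ ⟨x, rfl⟩
    refine le_trans ?_ h
    rw [← ofReal_norm, ← ofReal_norm, hval]
    exact ENNReal.ofReal_le_ofReal (WeightedHol.le_norm _ x)
  · intro h
    rcases eq_or_ne c ∞ with rfl | hc
    · exact le_top
    rw [← ofReal_norm]
    refine ENNReal.ofReal_le_of_le_toReal (WeightedHol.norm_le _ ENNReal.toReal_nonneg fun x => ?_)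
    rw [← hval, ← toReal_enorm]
    exact ENNReal.toReal_mono hc (h _ ⟨x, rfl⟩)

variable [CompleteSpace F]

/-- The hard implication for both cases: expand each point of the `v`-range in the bidual, then
descend to `F`. -/
theorem Covered.of_transpose {p : ℝ} (hp : 1 < p) {Q : Set (Seminorm ℂ F)}
    {Q' : Set (Seminorm ℂ (StrongDual ℂ (StrongDual ℂ F)))} (hQ : IsNorming Q)
    (hQ' : IsNorming (X := StrongDual ℂ (StrongDual ℂ F)) Q') (hT : FinitelyTestable (Y := StrongDual ℂ (StrongDual ℂ F)) Q Q' p) (f : WeightedHol v F)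
    {ψ : ℕ → StrongDual ℂ (StrongDual ℂ F)} {c d : ℝ≥0∞} (hψ : ULpBound (X := StrongDual ℂ (StrongDual ℂ F)) Q' p c ψ)
    (ht : ULpTail (X := StrongDual ℂ (StrongDual ℂ F)) Q' p ψ) (hfin : weakSeqENorm p ψ ≠ ∞)
    (hf : ∀ φ, ‖f.transpose φ‖ₑ ≤ seqENorm p (fun n => ψ n φ)) (hcd : c < d) :
    Covered Q p (fun y : f.vRange => (y : F)) d := by
  refine Covered.of_hellyMap hQ hQ' hp hT isHellyMap_inclusionInDoubleDual
    norm_inclusionInDoubleDual hcd ⟨ψ, hψ, ht, fun y => ?_⟩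
  refine mem_pConv_of_le_seqENorm hp hQ' ht (seqENorm_apply_ne_top (by linarith) hfin) fun φ => ?_
  exact (f.enorm_transpose_le_iff φ _).1 (hf φ) y y.2

end Transpose

/-! ### Both equivalences and the equalities of norms. -/

section Main

variable {E : Type*} [NormedAddCommGroup E] [NormedSpace ℂ E] {U : TopologicalSpace.Opens E}
  {v : Weight U} {F : Type*} [NormedAddCommGroup F] [NormedSpace ℂ F]

theorem WeightedHol.enorm_transpose_le_of_subset_pConv {p : ℝ} (hp : 1 < p) (f : WeightedHol v F)
    {x : ℕ → F} (hx : f.vRange ⊆ pConv p x) (φ : StrongDual ℂ F) :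
    ‖f.transpose φ‖ₑ ≤
      seqENorm p (fun n => NormedSpace.inclusionInDoubleDual ℂ F (x n) φ) :=
  (f.enorm_transpose_le_iff φ _).2 fun _ hy => enorm_apply_le_of_mem_pConv hp (hx hy) φ

theorem inclusionInDoubleDual_mem_pSummable {p : ℝ} {x : ℕ → F} (hx : x ∈ pSummable p F) :
    (fun n => NormedSpace.inclusionInDoubleDual ℂ F (x n)) ∈
      pSummable p (StrongDual ℂ (StrongDual ℂ F)) :=
  (seqENorm_inclusionInDoubleDual p x).trans_lt hx

theorem inclusionInDoubleDual_mem_unconditionallyPSummable {p : ℝ} {x : ℕ → F}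
    (hx : x ∈ unconditionallyPSummable p F) :
    (fun n => NormedSpace.inclusionInDoubleDual ℂ F (x n)) ∈
      unconditionallyPSummable p (StrongDual ℂ (StrongDual ℂ F)) :=
  ⟨(weakSeqENorm_inclusionInDoubleDual_le p x).trans_lt hx.1,
    tendsto_of_tendsto_of_tendsto_of_le_of_le tendsto_const_nhds hx.2 (fun _ => zero_le)
      fun m => weakSeqENorm_inclusionInDoubleDual_le p fun n => x (n + m)⟩

variable [CompleteSpace F]

theorem WeightedHol.exists_pSummable_of_transpose {p : ℝ} (hp : 1 < p) (f : WeightedHol v F)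
    {ψ : ℕ → StrongDual ℂ (StrongDual ℂ F)}
    (hψ : ψ ∈ pSummable p (StrongDual ℂ (StrongDual ℂ F)))
    (hf : ∀ φ, ‖f.transpose φ‖ₑ ≤ seqENorm p (fun n => ψ n φ)) {d : ℝ≥0∞}
    (hd : seqENorm p ψ < d) (hdt : d ≠ ∞) :
    ∃ x ∈ pSummable p F, f.vRange ⊆ pConv p x ∧ seqENorm p x ≤ d := by
  have hp0 : 0 < p := by linarith
  obtain ⟨x, hx, -, hxf⟩ := Covered.of_transpose hp isNorming_strongFamily isNorming_strongFamily
    (finitelyTestable_strongFamily hp) f ((ulpBound_strongFamily_iff hp0).2 le_rfl)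
    (ulpTail_strongFamily hp0 hψ) ((weakSeqENorm_le_seqENorm hp0.le ψ).trans_lt hψ).ne hf hd
  rw [ulpBound_strongFamily_iff hp0] at hx
  exact ⟨x, hx.trans_lt hdt.lt_top, fun y hy => hxf ⟨y, hy⟩, hx⟩

theorem WeightedHol.exists_unconditionallyPSummable_of_transpose {p : ℝ} (hp : 1 < p)
    (f : WeightedHol v F) {ψ : ℕ → StrongDual ℂ (StrongDual ℂ F)}
    (hψ : ψ ∈ unconditionallyPSummable p (StrongDual ℂ (StrongDual ℂ F)))
    (hf : ∀ φ, ‖f.transpose φ‖ₑ ≤ seqENorm p (fun n => ψ n φ)) {d : ℝ≥0∞}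
    (hd : weakSeqENorm p ψ < d) (hdt : d ≠ ∞) :
    ∃ x ∈ unconditionallyPSummable p F, f.vRange ⊆ pConv p x ∧ weakSeqENorm p x ≤ d := by
  have hp0 : 0 < p := by linarith
  obtain ⟨x, hx, hxt, hxf⟩ := Covered.of_transpose hp isNorming_weakFamily isNorming_weakFamily
    (finitelyTestable_weakFamily hp) f ((ulpBound_weakFamily_iff hp0).2 le_rfl)
    ((ulpTail_weakFamily_iff hp0).2 hψ.2) (ne_of_lt hψ.1) hf hd
  rw [ulpBound_weakFamily_iff hp0] at hx
  exact ⟨x, ⟨hx.trans_lt hdt.lt_top, (ulpTail_weakFamily_iff hp0).1 hxt⟩,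
    fun y hy => hxf ⟨y, hy⟩, hx⟩

theorem WeightedHol.normKp_eq_normQNp {p : ℝ} (hp : 1 < p) (f : WeightedHol v F) :
    f.normKp p = normQNp p f.transpose := by
  refine le_antisymm (le_sInf ?_) (le_sInf ?_)
  · rintro _ ⟨ψ, hψ, hf, rfl⟩
    -- Descent loses an arbitrarily small amount, which disappears in the infimum.
    refine le_of_forall_gt_imp_ge_of_dense fun d hd => ?_
    rcases eq_or_ne d ∞ with rfl | hdt
    · exact le_top
    obtain ⟨x, hx, hxf, hxd⟩ := f.exists_pSummable_of_transpose hp hψ hf hd hdt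
    exact le_trans (sInf_le ⟨x, hx, hxf, rfl⟩) hxd
  · rintro _ ⟨x, hx, hxf, rfl⟩
    exact sInf_le ⟨_, inclusionInDoubleDual_mem_pSummable hx,
      f.enorm_transpose_le_of_subset_pConv hp hxf, (seqENorm_inclusionInDoubleDual p x).symm⟩

theorem WeightedHol.normKup_eq_normQNup {p : ℝ} (hp : 1 < p) (f : WeightedHol v F) :
    f.normKup p = normQNup p f.transpose := by
  refine le_antisymm (le_sInf ?_) (le_sInf ?_)
  · rintro _ ⟨ψ, hψ, hf, rfl⟩
    refine le_of_forall_gt_imp_ge_of_dense fun d hd => ?_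
    rcases eq_or_ne d ∞ with rfl | hdt
    · exact le_top
    obtain ⟨x, hx, hxf, hxd⟩ := f.exists_unconditionallyPSummable_of_transpose hp hψ hf hd hdt
    exact le_trans (sInf_le ⟨x, hx, hxf, rfl⟩) hxd
  · rintro _ ⟨x, hx, hxf, rfl⟩
    exact le_trans (sInf_le ⟨_, inclusionInDoubleDual_mem_unconditionallyPSummable hx,
      f.enorm_transpose_le_of_subset_pConv hp hxf, rfl⟩)
      (weakSeqENorm_inclusionInDoubleDual_le p x)

theorem WeightedHol.mem_weightedHolKp_iff {p : ℝ} (hp : 1 < p) (f : WeightedHol v F) :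
    f ∈ WeightedHolKp v F p ↔ IsQuasiPNuclear p f.transpose := by
  constructor
  · rintro ⟨x, hx, hxf⟩
    exact ⟨_, inclusionInDoubleDual_mem_pSummable hx, f.enorm_transpose_le_of_subset_pConv hp hxf⟩
  · rintro ⟨ψ, hψ, hf⟩
    obtain ⟨d, hd, hdt⟩ := exists_between (show seqENorm p ψ < ∞ from hψ)
    obtain ⟨x, hx, hxf, -⟩ := f.exists_pSummable_of_transpose hp hψ hf hd hdt.ne
    exact ⟨x, hx, hxf⟩

theorem WeightedHol.mem_weightedHolKup_iff {p : ℝ} (hp : 1 < p) (f : WeightedHol v F) :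
    f ∈ WeightedHolKup v F p ↔ IsQuasiUPNuclear p f.transpose := by
  constructor
  · rintro ⟨x, hx, hxf⟩
    exact ⟨_, inclusionInDoubleDual_mem_unconditionallyPSummable hx,
      f.enorm_transpose_le_of_subset_pConv hp hxf⟩
  · rintro ⟨ψ, hψ, hf⟩
    obtain ⟨d, hd, hdt⟩ := exists_between (show weakSeqENorm p ψ < ∞ from hψ.1)
    obtain ⟨x, hx, hxf, -⟩ := f.exists_unconditionallyPSummable_of_transpose hp hψ hf hd hdt.ne
    exact ⟨x, hx, hxf⟩

end Main

theorem mainTheorem6 {E : Type*} [NormedAddCommGroup E] [NormedSpace ℂ E] [CompleteSpace E]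
    {F : Type*} [NormedAddCommGroup F] [NormedSpace ℂ F] [CompleteSpace F]
    (U : TopologicalSpace.Opens E) (v : Weight U) (p : ℝ) (hp : 1 < p) (f : WeightedHol v F) :
    ((f ∈ WeightedHolKp v F p ↔ IsQuasiPNuclear p f.transpose) ∧
      (f ∈ WeightedHolKp v F p → f.normKp p = normQNp p f.transpose)) ∧
    ((f ∈ WeightedHolKup v F p ↔ IsQuasiUPNuclear p f.transpose) ∧
      (f ∈ WeightedHolKup v F p → f.normKup p = normQNup p f.transpose)) :=
  ⟨⟨f.mem_weightedHolKp_iff hp, fun _ => f.normKp_eq_normQNp hp⟩,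
    ⟨f.mem_weightedHolKup_iff hp, fun _ => f.normKup_eq_normQNup hp⟩⟩
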